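/- Let $H^p(\mathbb{D}^2)$, $1\le p\le 2$, be the Hardy space of holomorphic functions $f$ on the bidisc with $\|f\|_p^p=\sup_{0<r<1}\int_{\mathbb{T}^2}|f(rz)|^p\,dm(z)<\infty$, where $m$ is the normalized Haar measure on the torus $\mathbb{T}^2$. For $w=(w^1,w^2)\in\mathbb{D}^2$ let $S_w(z)=\prod_{i=1}^2\frac{1}{1-\overline{w^i}z^i}$ be the Szegő kernel and $g_w=S_w/\|S_w\|_2$. For a finite set $\Lambda\subseteq\mathbb{D}^2$ let $$T^p_\Lambda:H^p(\mathbb{D}^2)\to\ell^p(\Lambda),\qquad T^p_\Lambda f=\Big(f(\lambda)\prod_{i=1}^2(1-|\lambda^i|^2)^{1/p}\Big)_{\lambda\in\Lambda}.$$ With $\langle\cdot,\cdot\rangle$ the inner product of $H^2(\mathbb{D}^2)$, call $\Lambda$ $\gamma$-weakly separated if $$\sqrt{1-\sup_{\lambda\ne\mu\in\Lambda}|\langle g_\lambda,g_\mu\rangle|^2}\ \ge\ \gamma$$ (the supremum over the empty set being $0$), and $\Delta$-column bounded if $\sup_{\mu\in\Lambda}\sum_{\lambda\in\Lambda,\,\lambda\neq\mu}|\langle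 g_\lambda,g_\mu\rangle|^2\le\Delta$. **Proposition 4.2.** For all $\gamma,\Delta>0$ there is a constant $C=C(\gamma,\Delta)>0$ such that for every $1\le p\le2$ and every finite set $\Lambda\subseteq\mathbb{D}^2$ which is $\gamma$-weakly separated, $\Delta$-column bounded, and on which $\lambda\mapsto\|S_\lambda\|_2$ is constant, there exists a bounded linear operator $R:\ell^p(\Lambda)\to H^p(\mathbb{D}^2)$ with $T^p_\Lambda R=\mathrm{Id}_{\ell^p(\Lambda)}$ and $\|R\|\le C$. -/

import Mathlib

open MeasureTheory Filter Topology
open scoped ENNReal ComplexConjugate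

noncomputable section

/-- The open unit bidisc `𝔻² ⊆ ℂ²`. -/
def bidisc : Set (ℂ × ℂ) := Metric.ball (0 : ℂ) 1 ×ˢ Metric.ball (0 : ℂ) 1

/-- The torus `𝕋²`, written additively as `(ℝ/ℤ)²`; its `volume` is the probability Haar measure. -/
abbrev Torus : Type := UnitAddCircle × UnitAddCircle

theorem volume_torus_univ : volume (Set.univ : Set Torus) = 1 := by
  rw [← Set.univ_prod_univ, Measure.volume_eq_prod, Measure.prod_prod, AddCircle.measure_univ]
  simp

/-- The point `r z` of `ℂ²`, where `z ∈ 𝕋²` has the angular coordinates `θ`. -/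
def torusPoint (r : ℝ) (θ : Torus) : ℂ × ℂ :=
  ((r : ℂ) * (AddCircle.toCircle θ.1 : ℂ), (r : ℂ) * (AddCircle.toCircle θ.2 : ℂ))

/-- The Hardy norm `sup_{0<r<1} (∫_{𝕋²} |f(rz)|^p dm(z))^{1/p}`, with values in `[0,∞]`. -/
def hardyENorm (p : ℝ≥0∞) (f : ℂ × ℂ → ℂ) : ℝ≥0∞ :=
  ⨆ r : Set.Ioo (0 : ℝ) 1, eLpNorm (fun θ : Torus => f (torusPoint r θ)) p volume

theorem torusPoint_mem {r : ℝ} (hr : r ∈ Set.Ioo (0 : ℝ) 1) (θ : Torus) :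
    torusPoint r θ ∈ bidisc := by
  have h := hr.1.le
  simp [bidisc, torusPoint, abs_of_nonneg h, Circle.norm_coe, hr.2]

theorem continuous_torusPoint (r : ℝ) : Continuous (torusPoint r) := by
  have h : Continuous (fun x : UnitAddCircle => (AddCircle.toCircle x : ℂ)) :=
    continuous_subtype_val.comp AddCircle.continuous_toCircle
  exact (continuous_const.mul (h.comp continuous_fst)).prodMk
    (continuous_const.mul (h.comp continuous_snd))

theorem continuous_comp_torusPoint {f : ℂ × ℂ → ℂ} (hf : DifferentiableOn ℂ f bidisc)
    {r : ℝ} (hr : r ∈ Set.Ioo (0 : ℝ) 1) : Continuous fun θ : Torus => f (torusPoint r θ) :=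
  hf.continuousOn.comp_continuous (continuous_torusPoint r) (torusPoint_mem hr)

theorem hardyENorm_zero (p : ℝ≥0∞) : hardyENorm p 0 = 0 := by
  simp [hardyENorm]

theorem hardyENorm_add_le {p : ℝ≥0∞} (hp : 1 ≤ p) {f g : ℂ × ℂ → ℂ}
    (hf : DifferentiableOn ℂ f bidisc) (hg : DifferentiableOn ℂ g bidisc) :
    hardyENorm p (f + g) ≤ hardyENorm p f + hardyENorm p g := by
  refine iSup_le fun r => ?_
  refine (eLpNorm_add_le (continuous_comp_torusPoint hf r.2).aestronglyMeasurable
    (continuous_comp_torusPoint hg r.2).aestronglyMeasurable hp).trans ?_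
  exact add_le_add
    (le_iSup (fun r : Set.Ioo (0 : ℝ) 1 =>
      eLpNorm (fun θ : Torus => f (torusPoint r θ)) p volume) r)
    (le_iSup (fun r : Set.Ioo (0 : ℝ) 1 =>
      eLpNorm (fun θ : Torus => g (torusPoint r θ)) p volume) r)

theorem hardyENorm_smul (p : ℝ≥0∞) (c : ℂ) (f : ℂ × ℂ → ℂ) :
    hardyENorm p (c • f) = ‖c‖ₑ * hardyENorm p f := by
  rw [hardyENorm, hardyENorm, ENNReal.mul_iSup]
  exact iSup_congr fun r =>
    eLpNorm_const_smul c (fun θ : Torus => f (torusPoint r θ)) p volume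

/-- The underlying vector space of `H^p(𝔻²)`: the holomorphic functions on `𝔻²` with finite
Hardy norm. A function on `𝔻²` is represented by its extension by zero to `ℂ²`, so that equality
of elements is equality on `𝔻²`. -/
def hardySubmodule (p : ℝ≥0∞) [Fact (1 ≤ p)] : Submodule ℂ (ℂ × ℂ → ℂ) where
  carrier := {f | DifferentiableOn ℂ f bidisc ∧ (∀ z, z ∉ bidisc → f z = 0) ∧
    hardyENorm p f < ∞}
  zero_mem' := ⟨differentiableOn_const 0, fun _ _ => rfl, by rw [hardyENorm_zero]; simp⟩
  add_mem' := by
    rintro f g ⟨hf, hf0, hf'⟩ ⟨hg, hg0, hg'⟩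
    exact ⟨hf.add hg, fun z hz => by simp [hf0 z hz, hg0 z hz],
      (hardyENorm_add_le Fact.out hf hg).trans_lt (ENNReal.add_lt_top.2 ⟨hf', hg'⟩)⟩
  smul_mem' := by
    rintro c f ⟨hf, hf0, hf'⟩
    exact ⟨hf.const_smul c, fun z hz => by simp [hf0 z hz],
      by rw [hardyENorm_smul]; exact ENNReal.mul_lt_top (by simp) hf'⟩

/-- The Hardy space `H^p(𝔻²)`, `1 ≤ p`. It is a type of its own, so that it carries only the
Hardy norm below and not the topology of pointwise convergence. -/
def HardySpace (p : ℝ≥0∞) [Fact (1 ≤ p)] : Type := hardySubmodule p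

namespace HardySpace

variable {p : ℝ≥0∞} [Fact (1 ≤ p)]

instance : AddCommGroup (HardySpace p) := inferInstanceAs (AddCommGroup (hardySubmodule p))

instance : Module ℂ (HardySpace p) := inferInstanceAs (Module ℂ (hardySubmodule p))

/-- The function on `ℂ²` (zero off `𝔻²`) that an element of `H^p(𝔻²)` is. -/
def toFun (f : HardySpace p) : ℂ × ℂ → ℂ := f.1

instance : CoeFun (HardySpace p) (fun _ => ℂ × ℂ → ℂ) := ⟨toFun⟩

theorem differentiableOn (f : HardySpace p) : DifferentiableOn ℂ f bidisc := f.2.1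

theorem eq_zero_of_notMem (f : HardySpace p) {z : ℂ × ℂ} (hz : z ∉ bidisc) : f z = 0 :=
  f.2.2.1 z hz

theorem hardyENorm_lt_top (f : HardySpace p) : hardyENorm p f < ∞ := f.2.2.2

theorem coe_zero : ((0 : HardySpace p) : ℂ × ℂ → ℂ) = 0 := rfl

theorem coe_add (f g : HardySpace p) : ((f + g : HardySpace p) : ℂ × ℂ → ℂ) = f + g := rfl

theorem coe_smul (c : ℂ) (f : HardySpace p) : ((c • f : HardySpace p) : ℂ × ℂ → ℂ) = c • ⇑f := rfl

theorem coe_neg (f : HardySpace p) : ((-f : HardySpace p) : ℂ × ℂ → ℂ) = -⇑f := rfl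

theorem ext {f g : HardySpace p} (h : ∀ z ∈ bidisc, f z = g z) : f = g := by
  refine Subtype.ext (funext fun z => ?_)
  by_cases hz : z ∈ bidisc
  · exact h z hz
  · exact (f.eq_zero_of_notMem hz).trans (g.eq_zero_of_notMem hz).symm

/-- The Hardy norm as a real number. -/
instance : Norm (HardySpace p) := ⟨fun f => (hardyENorm p f).toReal⟩

theorem norm_def (f : HardySpace p) : ‖f‖ = (hardyENorm p f).toReal := rfl

theorem eq_zero_of_norm_eq_zero (f : HardySpace p) (h : ‖f‖ = 0) : f = 0 := by
  have hp : p ≠ 0 := (zero_lt_one.trans_le (Fact.out : 1 ≤ p)).ne'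
  have h0 : hardyENorm p f = 0 := by
    rcases (ENNReal.toReal_eq_zero_iff _).1 h with h | h
    · exact h
    · exact absurd h f.hardyENorm_lt_top.ne
  have htor : ∀ r ∈ Set.Ioo (0 : ℝ) 1, ∀ θ : Torus, f (torusPoint r θ) = 0 := by
    intro r hr
    have hc := continuous_comp_torusPoint f.differentiableOn hr
    have h1 : eLpNorm (fun θ : Torus => f (torusPoint r θ)) p volume = 0 :=
      (ENNReal.iSup_eq_zero.1 h0) ⟨r, hr⟩
    rw [eLpNorm_eq_zero_iff hc.aestronglyMeasurable hp] at h1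
    exact congrFun ((hc.ae_eq_iff_eq volume continuous_zero).1 h1)
  have hsph : ∀ r ∈ Set.Ioo (0 : ℝ) 1, ∀ u ∈ Metric.sphere (0 : ℂ) r,
      ∃ x : UnitAddCircle, u = (r : ℂ) * (AddCircle.toCircle x : ℂ) := by
    intro r hr u hu
    have hr0 : (r : ℂ) ≠ 0 := by exact_mod_cast hr.1.ne'
    have hu' : ‖u‖ = r := by simpa using hu
    have hmem : u / r ∈ Submonoid.unitSphere ℂ := by
      simp [Submonoid.unitSphere, hu', abs_of_pos hr.1, hr.1.ne']
    obtain ⟨x, hx⟩ := (AddCircle.homeomorphCircle (T := 1) one_ne_zero).surjective ⟨u / r, hmem⟩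
    refine ⟨x, ?_⟩
    rw [AddCircle.homeomorphCircle_apply] at hx
    rw [hx]
    field_simp
  have hzero : ∀ r ∈ Set.Ioo (0 : ℝ) 1, ∀ k : ℂ → ℂ,
      DifferentiableOn ℂ k (Metric.ball 0 1) → (∀ u ∈ Metric.sphere (0 : ℂ) r, k u = 0) →
      ∀ u ∈ Metric.closedBall (0 : ℂ) r, k u = 0 := by
    intro r hr k hk hk0 u hu
    have hsub : Metric.closedBall (0 : ℂ) r ⊆ Metric.ball 0 1 := Metric.closedBall_subset_ball hr.2
    have hcl : closure (Metric.ball (0 : ℂ) r) = Metric.closedBall 0 r :=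
      closure_ball 0 hr.1.ne'
    have hd : DiffContOnCl ℂ k (Metric.ball (0 : ℂ) r) :=
      (hk.mono (hcl ▸ hsub)).diffContOnCl
    have := Complex.eqOn_closure_of_eqOn_frontier (g := fun _ => (0 : ℂ)) Metric.isBounded_ball hd
      diffContOnCl_const (fun v hv => hk0 v (Metric.frontier_ball_subset_sphere hv))
    exact this (hcl ▸ hu)
  refine HardySpace.ext fun z hz => ?_
  have hz' : ‖z.1‖ < 1 ∧ ‖z.2‖ < 1 := by simpa [bidisc] using hz
  obtain ⟨r, hr1, hr2⟩ := exists_between (max_lt (max_lt hz'.1 hz'.2) (zero_lt_one (α := ℝ)))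
  have hr : r ∈ Set.Ioo (0 : ℝ) 1 := ⟨(le_max_right _ _).trans_lt hr1, hr2⟩
  have hz1 : z.1 ∈ Metric.closedBall (0 : ℂ) r := by
    simpa using (((le_max_left _ _).trans (le_max_left _ _)).trans_lt hr1).le
  have hz2 : z.2 ∈ Metric.closedBall (0 : ℂ) r := by
    simpa using (((le_max_right _ _).trans (le_max_left _ _)).trans_lt hr1).le
  have hsub : Metric.closedBall (0 : ℂ) r ⊆ Metric.ball 0 1 := Metric.closedBall_subset_ball hr.2
  have step : ∀ v ∈ Metric.sphere (0 : ℂ) r, f (z.1, v) = 0 := by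
    intro v hv
    refine hzero r hr (fun u => f (u, v)) ?_ ?_ z.1 hz1
    · exact f.differentiableOn.comp (differentiableOn_id.prodMk (differentiableOn_const v))
        fun u hu => ⟨hu, hsub (Metric.sphere_subset_closedBall hv)⟩
    · intro u hu
      obtain ⟨x, rfl⟩ := hsph r hr u hu
      obtain ⟨y, rfl⟩ := hsph r hr v hv
      exact htor r hr (x, y)
  exact hzero r hr (fun v => f (z.1, v))
    (f.differentiableOn.comp ((differentiableOn_const z.1).prodMk differentiableOn_id)
      fun v hv => ⟨hz.1, hv⟩) step z.2 hz2

instance : NormedAddCommGroup (HardySpace p) :=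
  AddGroupNorm.toNormedAddCommGroup
    { toFun := fun f => ‖f‖
      map_zero' := by rw [norm_def, coe_zero, hardyENorm_zero]; rfl
      add_le' := fun f g => by
        rw [norm_def, norm_def, norm_def,
          ← ENNReal.toReal_add f.hardyENorm_lt_top.ne g.hardyENorm_lt_top.ne]
        exact ENNReal.toReal_mono
          (ENNReal.add_lt_top.2 ⟨f.hardyENorm_lt_top, g.hardyENorm_lt_top⟩).ne
          (hardyENorm_add_le Fact.out f.differentiableOn g.differentiableOn)
      neg' := fun f => by
        rw [norm_def, norm_def, coe_neg, ← neg_one_smul ℂ (f : ℂ × ℂ → ℂ), hardyENorm_smul]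
        simp
      eq_zero_of_map_eq_zero' := eq_zero_of_norm_eq_zero }

instance : NormedSpace ℂ (HardySpace p) where
  norm_smul_le c f := by
    change (hardyENorm p (c • f : HardySpace p)).toReal ≤ ‖c‖ * (hardyENorm p f).toReal
    rw [coe_smul, hardyENorm_smul, ENNReal.toReal_mul, toReal_enorm]

end HardySpace

/-- The restriction operator
`T_Λ^p f = (f(λ) (1-|λ¹|²)^{1/p} (1-|λ²|²)^{1/p})_{λ ∈ Λ}` from `H^p(𝔻²)` to `ℓ^p = ℓ^p(Λ)`. -/
def restrictionOp (p : ℝ≥0∞) [Fact (1 ≤ p)] (Λ : Finset bidisc) :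
    HardySpace p →ₗ[ℂ] PiLp p (fun _ : Λ => ℂ) where
  toFun f := WithLp.toLp p fun w : Λ =>
    f (w : ℂ × ℂ) * (((1 - ‖(w : ℂ × ℂ).1‖ ^ 2) ^ (1 / p.toReal) *
      (1 - ‖(w : ℂ × ℂ).2‖ ^ 2) ^ (1 / p.toReal) : ℝ) : ℂ)
  map_add' f g := by
    ext w
    simp [HardySpace.coe_add, add_mul]
  map_smul' c f := by
    ext w
    simp [HardySpace.coe_smul, mul_assoc]

/-- The Szegő kernel `S(z,w) = ∏_{i=1,2} 1 / (1 - conj(wⁱ) zⁱ)`. -/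
def szegoKernel (z w : ℂ × ℂ) : ℂ :=
  1 / (1 - conj w.1 * z.1) * (1 / (1 - conj w.2 * z.2))

theorem le_norm_one_sub {a b : ℂ} (hb : ‖b‖ < 1) : 1 - ‖a‖ ≤ ‖1 - conj a * b‖ := by
  have h1 : ‖(1 : ℂ)‖ - ‖conj a * b‖ ≤ ‖1 - conj a * b‖ := norm_sub_norm_le _ _
  have h2 : ‖conj a * b‖ ≤ ‖a‖ := by
    rw [norm_mul, RCLike.norm_conj]
    exact mul_le_of_le_one_right (norm_nonneg _) hb.le
  rw [norm_one] at h1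
  linarith

theorem szegoKernel_mem (w : bidisc) :
    (bidisc.indicator fun z => szegoKernel z w) ∈ hardySubmodule 2 := by
  have hw : ‖(w : ℂ × ℂ).1‖ < 1 ∧ ‖(w : ℂ × ℂ).2‖ < 1 := by simpa [bidisc] using w.2
  have hne : ∀ {a b : ℂ}, ‖a‖ < 1 → ‖b‖ < 1 → 1 - conj a * b ≠ 0 := fun {a b} ha hb h => by
    have := le_norm_one_sub (a := a) hb
    rw [h, norm_zero] at this
    linarith
  refine ⟨?_, fun z hz => Set.indicator_of_notMem hz _, ?_⟩
  · refine DifferentiableOn.congr (f := fun z => szegoKernel z w) (fun z hz => ?_)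
      (fun z hz => Set.indicator_of_mem hz _)
    have hz' : ‖z.1‖ < 1 ∧ ‖z.2‖ < 1 := by simpa [bidisc] using hz
    have h1 := hne hw.1 hz'.1
    have h2 := hne hw.2 hz'.2
    unfold szegoKernel
    apply DifferentiableAt.differentiableWithinAt
    fun_prop (disch := assumption)
  · have hbd : ∀ {a b : ℂ}, ‖a‖ < 1 → ‖b‖ < 1 →
        ‖1 / (1 - conj a * b)‖ ≤ 1 / (1 - ‖a‖) := fun {a b} ha hb => by
      rw [norm_div, norm_one]
      exact one_div_le_one_div_of_le (by linarith) (le_norm_one_sub hb)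
    have hle : hardyENorm 2 (bidisc.indicator fun z => szegoKernel z w) ≤
        ENNReal.ofReal (1 / (1 - ‖(w : ℂ × ℂ).1‖) * (1 / (1 - ‖(w : ℂ × ℂ).2‖))) := by
      refine iSup_le fun r => ?_
      refine (eLpNorm_le_of_ae_bound
        (C := 1 / (1 - ‖(w : ℂ × ℂ).1‖) * (1 / (1 - ‖(w : ℂ × ℂ).2‖)))
        (ae_of_all _ fun θ => ?_)).trans (by simp [volume_torus_univ])
      have hz := torusPoint_mem r.2 θ
      have hz' : ‖(torusPoint r θ).1‖ < 1 ∧ ‖(torusPoint r θ).2‖ < 1 := by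
        simpa [bidisc] using hz
      rw [Set.indicator_of_mem hz, szegoKernel, norm_mul]
      exact mul_le_mul (hbd hw.1 hz'.1) (hbd hw.2 hz'.2) (norm_nonneg _)
        (one_div_nonneg.2 (by linarith))
    exact hle.trans_lt ENNReal.ofReal_lt_top

/-- The function `S_w = S(·, w)` as an element of `H²(𝔻²)`. -/
def szego (w : bidisc) : HardySpace 2 :=
  ⟨bidisc.indicator fun z => szegoKernel z w, szegoKernel_mem w⟩

/-- The inner product `⟨f, h⟩ = lim_{r → 1⁻} ∫_{𝕋²} f(rz) conj(h(rz)) dm(z)` of `H²(𝔻²)`. -/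
def hardyInner (f h : HardySpace 2) : ℂ :=
  limUnder (𝓝[<] (1 : ℝ)) fun r => ∫ θ : Torus, f (torusPoint r θ) * conj (h (torusPoint r θ))

/-- The normalized Szegő kernel `g_w = S_w / ‖S_w‖₂`. -/
def normalizedSzego (w : bidisc) : HardySpace 2 := ((‖szego w‖ : ℂ)⁻¹) • szego w

/-- The Gram matrix `⟨g_n, g_m⟩` of the family of points `l`. -/
def gramMatrix {ι : Type*} (l : ι → bidisc) : Matrix ι ι ℂ :=
  fun n m => hardyInner (normalizedSzego (l n)) (normalizedSzego (l m))

/-- The constant of weak separation `√(1 - (sup_{n ≠ m} |⟨g_n, g_m⟩|)²)`. The entries of the Gram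
matrix are bounded by `1`; the supremum is `0` if there are no two indices. -/
def weakSepConst {ι : Type*} (l : ι → bidisc) : ℝ :=
  √(1 - (⨆ q : {q : ι × ι // q.1 ≠ q.2}, ‖gramMatrix l q.1.1 q.1.2‖) ^ 2)

/-- The column boundedness constant `sup_m ∑_{n ≠ m} |⟨g_n, g_m⟩|²`, with values in `[0,∞]`. -/
def columnConst {ι : Type*} (l : ι → bidisc) : ℝ≥0∞ :=
  ⨆ m : ι, ∑' n : {n : ι // n ≠ m}, ‖gramMatrix l n m‖ₑ ^ 2

/-- `Λ` is `γ` weakly separated: its constant of weak separation is at least `γ`. -/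
def IsWeaklySeparatedWith (γ : ℝ) (Λ : Finset bidisc) : Prop :=
  γ ≤ weakSepConst (fun w : Λ => (w : bidisc))

/-- `Λ` is `Δ` column bounded: its column boundedness constant is at most `Δ`. -/
def IsColumnBoundedWith (Δ : ℝ) (Λ : Finset bidisc) : Prop :=
  columnConst (fun w : Λ => (w : bidisc)) ≤ ENNReal.ofReal Δ

end

/-!
On `Λ` the norm `‖S_λ‖₂` is constant; let `q = ‖S_λ‖₂⁻² = ∏ᵢ (1 - |λⁱ|²)`, so that
`|⟨g_λ, g_μ⟩| = q |S(μ, λ)|`. Data `a ∈ ℓ^p(Λ)` are interpolated approximately by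
`T a = ∑ a_λ q^{-1/p} (q S_λ)^k` with a large even exponent `k = 2s + 2`. The matrix of `T_Λ^p T`
has the entries `(q S(μ, λ))^k`: it is `1` on the diagonal, and off the diagonal
weak separation and column boundedness give row and column sums at most `(1 - γ²)^s Δ ≤ 1/2`. By the
Schur test (`schur_test`) it is within `1/2` of the identity on every `ℓ^p(Λ)`, hence invertible with
inverse of norm at most `2`, and `T` composed with this inverse is the desired `R`.

What remains is a bound for `T` that is uniform in `p`. Since `q` is constant, `a ↦ ∑ a_λ (q S_λ)^k`
is one and the same operator for all `p`.

* In `L²` (`integral_sq_synthesis_le`) Parseval's identity expresses the norm through the squared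
  power series coefficients of `S^k`. By `choose_add_sq_le` these are dominated by those
  of `S^{2k-1}`, so the quadratic form is at most a constant times the Gram form of `S^{2k-1}`, whose
  entries are bounded by `|⟨g_λ, g_μ⟩|²` (`integral_normSq_sum_szegoKernel_pow_le`). Column
  boundedness finishes the estimate.
* In `L¹` the triangle inequality suffices, because `‖S^{2j}‖₁ = ‖S^j‖₂²`.
* For `1 < p < 2`, real interpolation with a constant independent of `p` (`lintegral_rpow_sum_le`).
-/

/-! ### Parseval's identity for power series on the torus -/

instance : IsProbabilityMeasure (volume : Measure Torus) := ⟨volume_torus_univ⟩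

/-- Parseval's identity for absolutely convergent series in a bounded orthonormal family. -/
theorem integral_tsum_mul_conj_tsum {ι Ω : Type*} [Countable ι] [MeasurableSpace Ω]
    {ν : Measure Ω} [IsProbabilityMeasure ν] {χ : ι → Ω → ℂ}
    (hm : ∀ i, AEStronglyMeasurable (χ i) ν) (hb : ∀ i x, ‖χ i x‖ ≤ 1)
    (ho : ∀ i j, ∫ x, χ i x * conj (χ j x) ∂ν = Set.indicator {i} 1 j)
    {α β : ι → ℂ} (hα : Summable fun i => ‖α i‖) (hβ : Summable fun i => ‖β i‖) :
    ∫ x, (∑' i, α i * χ i x) * conj (∑' i, β i * χ i x) ∂ν = ∑' i, α i * conj (β i) := by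
  have hα' : ∀ x, Summable fun i => ‖α i * χ i x‖ := fun x =>
    hα.of_nonneg_of_le (fun _ => norm_nonneg _) fun i => by
      rw [norm_mul]; exact mul_le_of_le_one_right (norm_nonneg _) (hb i x)
  have hβ' : ∀ x, Summable fun i => ‖conj (β i * χ i x)‖ := fun x =>
    hβ.of_nonneg_of_le (fun _ => norm_nonneg _) fun i => by
      rw [RCLike.norm_conj, norm_mul]; exact mul_le_of_le_one_right (norm_nonneg _) (hb i x)
  have hprod : Summable fun q : ι × ι => ‖α q.1‖ * ‖β q.2‖ :=
    hα.mul_of_nonneg hβ (fun _ => norm_nonneg _) (fun _ => norm_nonneg _)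
  have hle : ∀ (q : ι × ι) (x : Ω),
      ‖α q.1 * χ q.1 x * conj (β q.2 * χ q.2 x)‖ ≤ ‖α q.1‖ * ‖β q.2‖ := fun q x => by
    rw [norm_mul, RCLike.norm_conj, norm_mul, norm_mul]
    exact mul_le_mul (mul_le_of_le_one_right (norm_nonneg _) (hb _ x))
      (mul_le_of_le_one_right (norm_nonneg _) (hb _ x)) (by positivity) (norm_nonneg _)
  have hint : ∀ q : ι × ι,
      Integrable (fun x => α q.1 * χ q.1 x * conj (β q.2 * χ q.2 x)) ν := fun q =>
    Integrable.of_bound (((hm q.1).const_mul _).mul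
      (RCLike.continuous_conj.comp_aestronglyMeasurable ((hm q.2).const_mul _))) _
      (ae_of_all _ (hle q))
  have hsum : Summable fun q : ι × ι =>
      ∫ x, ‖α q.1 * χ q.1 x * conj (β q.2 * χ q.2 x)‖ ∂ν :=
    hprod.of_nonneg_of_le (fun q => integral_nonneg fun _ => norm_nonneg _) fun q => by
      refine (integral_mono (hint q).norm (integrable_const _) (hle q)).trans ?_
      simp
  have hval : ∀ q : ι × ι, ∫ x, α q.1 * χ q.1 x * conj (β q.2 * χ q.2 x) ∂ν =
      α q.1 * conj (β q.2) * Set.indicator {q.1} 1 q.2 := fun q => by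
    rw [← ho, ← integral_const_mul]
    refine integral_congr_ae (ae_of_all _ fun x => ?_)
    simp only [map_mul]
    ring
  have h := hasSum_integral_of_summable_integral_norm hint hsum
  have hL : ∀ x, (∑' i, α i * χ i x) * conj (∑' i, β i * χ i x) =
      ∑' q : ι × ι, α q.1 * χ q.1 x * conj (β q.2 * χ q.2 x) := fun x => by
    rw [Complex.conj_tsum]
    exact tsum_mul_tsum_of_summable_norm (hα' x) (hβ' x)
  simp only [hL]
  rw [← h.tsum_eq, h.summable.tsum_prod]
  refine tsum_congr fun i => ?_
  rw [tsum_congr fun j => hval (i, j), tsum_eq_single i fun j hj => by simp [hj]]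
  simp

/-- The monomial `z₁^{n₁} z₂^{n₂}` on the torus. -/
noncomputable def torusMonomial (n : ℕ × ℕ) (θ : Torus) : ℂ :=
  (AddCircle.toCircle θ.1 : ℂ) ^ n.1 * (AddCircle.toCircle θ.2 : ℂ) ^ n.2

theorem continuous_torusMonomial (n : ℕ × ℕ) : Continuous (torusMonomial n) := by
  have h : Continuous (fun x : UnitAddCircle => (AddCircle.toCircle x : ℂ)) :=
    continuous_subtype_val.comp AddCircle.continuous_toCircle
  exact ((h.comp continuous_fst).pow _).mul ((h.comp continuous_snd).pow _)

theorem norm_torusMonomial (n : ℕ × ℕ) (θ : Torus) : ‖torusMonomial n θ‖ = 1 := by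
  simp [torusMonomial, Circle.norm_coe]

theorem integral_toCircle_pow_mul_conj (n m : ℕ) :
    ∫ x : UnitAddCircle, (AddCircle.toCircle x : ℂ) ^ n * conj ((AddCircle.toCircle x : ℂ) ^ m) =
      Set.indicator {n} 1 m := by
  have h := congrFun (fourierCoeff_fourier (T := 1) (n : ℤ)) (m : ℤ)
  have hf : ∀ (k : ℕ) (x : UnitAddCircle), fourier (k : ℤ) x = (AddCircle.toCircle x : ℂ) ^ k := by
    intro k x
    rw [fourier_apply, natCast_zsmul, AddCircle.toCircle_nsmul, Circle.coe_pow]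
  rw [fourierCoeff] at h
  rw [AddCircle.volume_eq_smul_haarAddCircle]
  simp only [ENNReal.ofReal_one, one_smul]
  calc _ = ∫ t : UnitAddCircle, fourier (-(m : ℤ)) t • (fourier (n : ℤ) t : ℂ)
        ∂AddCircle.haarAddCircle := by
        refine integral_congr_ae (ae_of_all _ fun x => ?_)
        simp only [fourier_neg, hf, smul_eq_mul, mul_comm]
    _ = _ := by
        rw [h]
        by_cases hnm : m = n <;> simp [hnm]

theorem integral_torusMonomial (n m : ℕ × ℕ) :
    ∫ θ : Torus, torusMonomial n θ * conj (torusMonomial m θ) = Set.indicator {n} 1 m := by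
  have h := integral_prod_mul (μ := (volume : Measure UnitAddCircle))
    (ν := (volume : Measure UnitAddCircle))
    (fun x => (AddCircle.toCircle x : ℂ) ^ n.1 * conj ((AddCircle.toCircle x : ℂ) ^ m.1))
    (fun x => (AddCircle.toCircle x : ℂ) ^ n.2 * conj ((AddCircle.toCircle x : ℂ) ^ m.2))
  rw [integral_toCircle_pow_mul_conj, integral_toCircle_pow_mul_conj] at h
  have e : (fun θ : Torus => torusMonomial n θ * conj (torusMonomial m θ)) = fun θ : Torus =>
      ((AddCircle.toCircle θ.1 : ℂ) ^ n.1 * conj ((AddCircle.toCircle θ.1 : ℂ) ^ m.1)) *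
        ((AddCircle.toCircle θ.2 : ℂ) ^ n.2 * conj ((AddCircle.toCircle θ.2 : ℂ) ^ m.2)) := by
    funext θ
    simp only [torusMonomial, map_mul]
    ring
  rw [e, Measure.volume_eq_prod, h]
  obtain ⟨n1, n2⟩ := n
  obtain ⟨m1, m2⟩ := m
  by_cases h1 : m1 = n1 <;> by_cases h2 : m2 = n2 <;> simp [h1, h2]

theorem integral_tsum_torusMonomial {α β : ℕ × ℕ → ℂ} (hα : Summable fun n => ‖α n‖)
    (hβ : Summable fun n => ‖β n‖) :
    ∫ θ : Torus, (∑' n, α n * torusMonomial n θ) * conj (∑' n, β n * torusMonomial n θ) =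
      ∑' n, α n * conj (β n) :=
  integral_tsum_mul_conj_tsum (fun n => (continuous_torusMonomial n).aestronglyMeasurable)
    (fun n θ => (norm_torusMonomial n θ).le) integral_torusMonomial hα hβ

/-! ### Powers of the Szegő kernel -/

/-- The coefficient of `u₁^{n₁} u₂^{n₂}` in `((1 - u₁)(1 - u₂))^{-(m+1)}`. -/
def powCoeff (m : ℕ) (n : ℕ × ℕ) : ℕ := (n.1 + m).choose m * (n.2 + m).choose m

/-- The term of index `n` of the power series of `S(z, w)^{m+1}`. -/
noncomputable def szegoTerm (m : ℕ) (z w : ℂ × ℂ) (n : ℕ × ℕ) : ℂ :=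
  powCoeff m n * ((conj w.1 * z.1) ^ n.1 * (conj w.2 * z.2) ^ n.2)

theorem szegoTerm_eq (m : ℕ) (z w : ℂ × ℂ) (n : ℕ × ℕ) : szegoTerm m z w n =
    ((n.1 + m).choose m * (conj w.1 * z.1) ^ n.1) *
      ((n.2 + m).choose m * (conj w.2 * z.2) ^ n.2) := by
  simp only [szegoTerm, powCoeff]
  push_cast
  ring

theorem summable_norm_choose_mul_pow (m : ℕ) {u : ℂ} (hu : ‖u‖ < 1) :
    Summable fun n : ℕ => ‖((n + m).choose m : ℂ) * u ^ n‖ := by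
  simpa using (hasSum_choose_mul_geometric_of_norm_lt_one m (r := ‖u‖) (by simpa using hu)).summable

theorem summable_norm_szegoTerm (m : ℕ) {z w : ℂ × ℂ} (h1 : ‖conj w.1 * z.1‖ < 1)
    (h2 : ‖conj w.2 * z.2‖ < 1) : Summable fun n => ‖szegoTerm m z w n‖ := by
  have h := (summable_norm_choose_mul_pow m h1).mul_norm (summable_norm_choose_mul_pow m h2)
  exact h.congr fun n => by rw [szegoTerm_eq]

theorem hasSum_szegoTerm (m : ℕ) {z w : ℂ × ℂ} (h1 : ‖conj w.1 * z.1‖ < 1)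
    (h2 : ‖conj w.2 * z.2‖ < 1) : HasSum (szegoTerm m z w) (szegoKernel z w ^ (m + 1)) := by
  have h : ∑' n, szegoTerm m z w n = szegoKernel z w ^ (m + 1) := by
    simp only [szegoTerm_eq]
    rw [← tsum_mul_tsum_of_summable_norm (summable_norm_choose_mul_pow m h1)
      (summable_norm_choose_mul_pow m h2), tsum_choose_mul_geometric_of_norm_lt_one m h1,
      tsum_choose_mul_geometric_of_norm_lt_one m h2, szegoKernel, mul_pow, one_div_pow, one_div_pow]
  exact h ▸ (summable_norm_szegoTerm m h1 h2).of_norm.hasSum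

theorem norm_fst_lt_one {z : ℂ × ℂ} (hz : z ∈ bidisc) : ‖z.1‖ < 1 := by
  simpa using hz.1

theorem norm_snd_lt_one {z : ℂ × ℂ} (hz : z ∈ bidisc) : ‖z.2‖ < 1 := by
  simpa using hz.2

theorem norm_conj_mul_lt_one {a b : ℂ} (ha : ‖a‖ < 1) (hb : ‖b‖ < 1) : ‖conj a * b‖ < 1 := by
  rw [norm_mul, RCLike.norm_conj]
  exact mul_lt_one_of_nonneg_of_lt_one_left (norm_nonneg _) ha hb.le

/-- Both sides are compared through
`(2m choose m) (n+2m choose 2m) = (n+2m choose m) (n+m choose m)`. -/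
theorem choose_add_sq_le (n m : ℕ) :
    (n + m).choose m ^ 2 ≤ (2 * m).choose m * (n + 2 * m).choose (2 * m) := by
  have h := Nat.choose_mul (n := n + 2 * m) (k := 2 * m) (s := m) (by omega)
  have e1 : n + 2 * m - m = n + m := by omega
  have e2 : 2 * m - m = m := by omega
  rw [e1, e2] at h
  rw [mul_comm, h, sq]
  exact Nat.mul_le_mul_right _ (Nat.choose_le_choose _ (by omega))

theorem powCoeff_sq_le (m : ℕ) (n : ℕ × ℕ) :
    powCoeff m n ^ 2 ≤ (2 * m).choose m ^ 2 * powCoeff (2 * m) n := by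
  calc powCoeff m n ^ 2 = (n.1 + m).choose m ^ 2 * (n.2 + m).choose m ^ 2 := by
        simp [powCoeff, mul_pow]
    _ ≤ _ := Nat.mul_le_mul (choose_add_sq_le _ _) (choose_add_sq_le _ _)
    _ = _ := by simp only [powCoeff]; ring

theorem szegoTerm_torusPoint (m : ℕ) (r : ℝ) (θ : Torus) (w : ℂ × ℂ) (n : ℕ × ℕ) :
    szegoTerm m (torusPoint r θ) w n = szegoTerm m (r, r) w n * torusMonomial n θ := by
  simp only [szegoTerm, torusPoint, torusMonomial]
  ring

theorem summable_norm_szegoTerm_real (m : ℕ) {r : ℝ} (hr : r ∈ Set.Ioo (0 : ℝ) 1) {w : ℂ × ℂ}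
    (hw : w ∈ bidisc) : Summable fun n => ‖szegoTerm m (r, r) w n‖ := by
  have hr' : ‖(r : ℂ)‖ < 1 := by simpa [abs_of_pos hr.1] using hr.2
  exact summable_norm_szegoTerm m (norm_conj_mul_lt_one (norm_fst_lt_one hw) hr')
    (norm_conj_mul_lt_one (norm_snd_lt_one hw) hr')

theorem szegoKernel_torusPoint_pow (m : ℕ) {r : ℝ} (hr : r ∈ Set.Ioo (0 : ℝ) 1) (θ : Torus)
    {w : ℂ × ℂ} (hw : w ∈ bidisc) :
    HasSum (fun n => szegoTerm m (r, r) w n * torusMonomial n θ)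
      (szegoKernel (torusPoint r θ) w ^ (m + 1)) := by
  have hz := torusPoint_mem hr θ
  rw [← funext fun n => szegoTerm_torusPoint m r θ w n]
  exact hasSum_szegoTerm m
    (norm_conj_mul_lt_one (norm_fst_lt_one hw) (norm_fst_lt_one hz))
    (norm_conj_mul_lt_one (norm_snd_lt_one hw) (norm_snd_lt_one hz))

/-- The reproducing property `⟨S_v, S_w⟩ = S(w, v)` at radius `r` in place of `1`. -/
theorem integral_szegoKernel_mul_conj {r : ℝ} (hr : r ∈ Set.Ioo (0 : ℝ) 1) {v w : ℂ × ℂ}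
    (hv : v ∈ bidisc) (hw : w ∈ bidisc) :
    ∫ θ : Torus, szegoKernel (torusPoint r θ) v * conj (szegoKernel (torusPoint r θ) w) =
      szegoKernel (r ^ 2 * w.1, r ^ 2 * w.2) v := by
  have key : ∀ {u : ℂ × ℂ}, u ∈ bidisc → ∀ θ : Torus, szegoKernel (torusPoint r θ) u =
      ∑' n, szegoTerm 0 (r, r) u n * torusMonomial n θ := fun hu θ => by
    rw [(szegoKernel_torusPoint_pow 0 hr θ hu).tsum_eq, zero_add, pow_one]
  simp only [key hv, key hw]
  rw [integral_tsum_torusMonomial (summable_norm_szegoTerm_real 0 hr hv)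
    (summable_norm_szegoTerm_real 0 hr hw)]
  have hrw : ∀ {a : ℂ}, ‖a‖ < 1 → ‖(r : ℂ) ^ 2 * a‖ < 1 := fun {a} ha => by
    rw [norm_mul, norm_pow, Complex.norm_real, Real.norm_eq_abs, abs_of_pos hr.1]
    exact mul_lt_one_of_nonneg_of_lt_one_right (pow_le_one₀ hr.1.le hr.2.le) (norm_nonneg _) ha
  have := (hasSum_szegoTerm 0 (z := (r ^ 2 * w.1, r ^ 2 * w.2)) (w := v)
    (norm_conj_mul_lt_one (norm_fst_lt_one hv) (hrw (norm_fst_lt_one hw)))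
    (norm_conj_mul_lt_one (norm_snd_lt_one hv) (hrw (norm_snd_lt_one hw)))).tsum_eq
  rw [zero_add, pow_one] at this
  rw [← this]
  refine tsum_congr fun n => ?_
  simp only [szegoTerm, powCoeff, Nat.choose_zero_right, map_mul, map_pow, Complex.conj_conj,
    Complex.conj_ofReal, map_natCast]
  push_cast
  ring

/-- The squared coefficients of `S^{m+1}` are dominated by the coefficients of `S^{2m+1}`, so a
combination of the functions `S_w^{m+1}` has an `L²` norm controlled by the Gram form of
the kernel `S^{2m+1}`. -/
theorem integral_normSq_sum_szegoKernel_pow_le {ι : Type*} [Fintype ι] (m : ℕ) {r : ℝ}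
    (hr : r ∈ Set.Ioo (0 : ℝ) 1) (w : ι → bidisc) (a : ι → ℂ) :
    ∫ θ : Torus, ‖∑ i, a i * szegoKernel (torusPoint r θ) (w i) ^ (m + 1)‖ ^ 2 ≤
      ((2 * m).choose m : ℝ) ^ 2 *
        ∑ i, ∑ j, ‖a i‖ * ‖a j‖ * ‖szegoKernel (w j) (w i)‖ ^ (2 * m + 1) := by
  set α : ℕ × ℕ → ℂ := fun n => ∑ i, a i * szegoTerm m (r, r) (w i) n with hα
  set A : ℕ × ℕ → ℂ := fun n =>
    ∑ i, a i * ((conj (w i : ℂ × ℂ).1) ^ n.1 * (conj (w i : ℂ × ℂ).2) ^ n.2) with hA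
  have hαs : Summable fun n => ‖α n‖ := by
    refine Summable.of_nonneg_of_le (fun _ => norm_nonneg _) (fun n => norm_sum_le _ _)
      (summable_sum fun i _ => ?_)
    simp only [norm_mul]
    exact (summable_norm_szegoTerm_real m hr (w i).2).mul_left _
  have hF : ∀ θ : Torus, ∑ i, a i * szegoKernel (torusPoint r θ) (w i) ^ (m + 1) =
      ∑' n, α n * torusMonomial n θ := fun θ => by
    have := hasSum_sum (s := Finset.univ) fun (i : ι) _ =>
      (szegoKernel_torusPoint_pow m hr θ (w i).2).mul_left (a i)
    rw [← this.tsum_eq]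
    refine tsum_congr fun n => ?_
    simp only [hα, Finset.sum_mul, mul_assoc]
  have hαA : ∀ n, α n = powCoeff m n * ((r : ℂ) ^ n.1 * (r : ℂ) ^ n.2) * A n := fun n => by
    simp only [hα, hA, Finset.mul_sum, szegoTerm]
    exact Finset.sum_congr rfl fun i _ => by ring
  have hI : ((∫ θ : Torus, ‖∑ i, a i * szegoKernel (torusPoint r θ) (w i) ^ (m + 1)‖ ^ 2 : ℝ) : ℂ)
      = ((∑' n, ‖α n‖ ^ 2 : ℝ) : ℂ) := by
    rw [← integral_complex_ofReal, Complex.ofReal_tsum]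
    have := integral_tsum_torusMonomial hαs hαs
    simp only [Complex.mul_conj'] at this
    simp only [hF]
    push_cast
    exact this
  have hB : HasSum (fun n => (powCoeff (2 * m) n : ℂ) * (A n * conj (A n)))
      (∑ i, ∑ j, a i * conj (a j) * szegoKernel (w j) (w i) ^ (2 * m + 1)) := by
    have := hasSum_sum (s := Finset.univ) fun (i : ι) _ => hasSum_sum (s := Finset.univ)
      fun (j : ι) _ => (hasSum_szegoTerm (2 * m) (z := w j) (w := w i)
        (norm_conj_mul_lt_one (norm_fst_lt_one (w i).2) (norm_fst_lt_one (w j).2))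
        (norm_conj_mul_lt_one (norm_snd_lt_one (w i).2) (norm_snd_lt_one (w j).2))).mul_left
          (a i * conj (a j))
    convert! this using 1
    funext n
    simp only [hA, map_sum, Finset.sum_mul_sum]
    simp only [Finset.mul_sum]
    refine Finset.sum_congr rfl fun i _ => Finset.sum_congr rfl fun j _ => ?_
    simp only [szegoTerm, map_mul, map_pow, Complex.conj_conj]
    ring
  have hB' : HasSum (fun n => (powCoeff (2 * m) n : ℝ) * ‖A n‖ ^ 2)
      (∑ i, ∑ j, a i * conj (a j) * szegoKernel (w j) (w i) ^ (2 * m + 1)).re := by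
    have := Complex.hasSum_re hB
    convert! this using 1
    funext n
    rw [Complex.mul_conj']
    norm_cast
  have hle : ∀ n, ‖α n‖ ^ 2 ≤
      ((2 * m).choose m : ℝ) ^ 2 * ((powCoeff (2 * m) n : ℝ) * ‖A n‖ ^ 2) := fun n => by
    have h1 : ((powCoeff m n : ℝ)) ^ 2 ≤ ((2 * m).choose m : ℝ) ^ 2 * powCoeff (2 * m) n := by
      exact_mod_cast powCoeff_sq_le m n
    have h2 : ‖(r : ℂ) ^ n.1 * (r : ℂ) ^ n.2‖ ≤ 1 := by
      rw [norm_mul, norm_pow, norm_pow, Complex.norm_real, Real.norm_eq_abs, abs_of_pos hr.1]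
      exact mul_le_one₀ (pow_le_one₀ hr.1.le hr.2.le) (by have := hr.1; positivity)
        (pow_le_one₀ hr.1.le hr.2.le)
    rw [hαA, norm_mul, norm_mul, mul_pow, mul_pow, ← mul_assoc, Complex.norm_natCast]
    refine mul_le_mul_of_nonneg_right ?_ (by positivity)
    exact (mul_le_of_le_one_right (by positivity) (pow_le_one₀ (norm_nonneg _) h2)).trans h1
  have hB'' := hB'.mul_left (((2 * m).choose m : ℝ) ^ 2)
  rw [Complex.ofReal_injective hI]
  calc ∑' n, ‖α n‖ ^ 2 ≤ _ := (Summable.of_nonneg_of_le (fun _ => by positivity) hle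
        hB''.summable).tsum_le_tsum hle hB''.summable
    _ = _ := hB''.tsum_eq
    _ ≤ _ := by
      refine mul_le_mul_of_nonneg_left ?_ (by positivity)
      refine (Complex.re_le_norm _).trans ((norm_sum_le _ _).trans (Finset.sum_le_sum fun i _ =>
        (norm_sum_le _ _).trans (Finset.sum_le_sum fun j _ => ?_)))
      simp

/-! ### Interpolation between `ℓ¹ → L¹` and `ℓ² → L²` -/

/-- The gauge `min u u²` at `u = x / t`, weighted by `t^{p-1}`. For `1 < p < 2` its integral over all
scales `t > 0` is `x^p` times a constant, see `lintegral_scaleGauge`. -/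
noncomputable def scaleGauge (p x t : ℝ) : ℝ := t ^ (p - 1) * min (x / t) ((x / t) ^ 2)

theorem scaleGauge_nonneg {p x t : ℝ} (hx : 0 ≤ x) (ht : 0 < t) : 0 ≤ scaleGauge p x t := by
  unfold scaleGauge
  positivity

theorem measurable_scaleGauge (p : ℝ) : Measurable fun q : ℝ × ℝ => scaleGauge p q.1 q.2 := by
  unfold scaleGauge
  fun_prop

theorem scaleGauge_of_le {p x t : ℝ} (ht : 0 < t) (h : t ≤ x) :
    scaleGauge p x t = x * t ^ (p - 2) := by
  have h1 : 1 ≤ x / t := (one_le_div ht).2 h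
  rw [scaleGauge, min_eq_left (by nlinarith), show p - 1 = p - 2 + 1 by ring,
    Real.rpow_add_one ht.ne']
  field_simp

theorem scaleGauge_of_ge {p x t : ℝ} (hx : 0 ≤ x) (ht : 0 < t) (h : x ≤ t) :
    scaleGauge p x t = x ^ 2 * t ^ (p - 3) := by
  have h1 : x / t ≤ 1 := (div_le_one ht).2 h
  have h0 : 0 ≤ x / t := by positivity
  rw [scaleGauge, min_eq_right (by nlinarith), show p - 1 = p - 3 + 1 + 1 by ring,
    Real.rpow_add_one ht.ne', Real.rpow_add_one ht.ne']
  field_simp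

theorem lintegral_scaleGauge {p : ℝ} (hp1 : 1 < p) (hp2 : p < 2) {x : ℝ} (hx : 0 ≤ x) :
    ∫⁻ t in Set.Ioi (0 : ℝ), ENNReal.ofReal (scaleGauge p x t) =
      ENNReal.ofReal ((1 / (p - 1) + 1 / (2 - p)) * x ^ p) := by
  rcases hx.eq_or_lt with rfl | hx
  · rw [Real.zero_rpow (by linarith)]
    simp [scaleGauge]
  have hI1 : IntegrableOn (fun t : ℝ => x * t ^ (p - 2)) (Set.Ioc 0 x) :=
    ((intervalIntegrable_iff_integrableOn_Ioc_of_le hx.le).1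
      (intervalIntegral.intervalIntegrable_rpow' (by linarith))).const_mul _
  have hI2 : IntegrableOn (fun t : ℝ => x ^ 2 * t ^ (p - 3)) (Set.Ioi x) :=
    (integrableOn_Ioi_rpow_of_lt (by linarith) hx).const_mul _
  have e1 : ∫⁻ t in Set.Ioc 0 x, ENNReal.ofReal (scaleGauge p x t) =
      ENNReal.ofReal (1 / (p - 1) * x ^ p) := by
    rw [setLIntegral_congr_fun measurableSet_Ioc
      (g := fun t => ENNReal.ofReal (x * t ^ (p - 2)))
      (fun t ht => by simp only [scaleGauge_of_le ht.1 ht.2]),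
      ← ofReal_integral_eq_lintegral_ofReal hI1
        ((ae_restrict_iff' measurableSet_Ioc).2 (ae_of_all _ fun t ht => by
          have := ht.1; simp only [Pi.zero_apply]; positivity)),
      integral_const_mul, ← intervalIntegral.integral_of_le hx.le,
      integral_rpow (Or.inl (by linarith)), show p - 2 + 1 = p - 1 by ring,
      Real.zero_rpow (by linarith)]
    congr 1
    rw [sub_zero, show p = p - 1 + 1 by ring, Real.rpow_add_one hx.ne']
    ring_nf
  have e2 : ∫⁻ t in Set.Ioi x, ENNReal.ofReal (scaleGauge p x t) =
      ENNReal.ofReal (1 / (2 - p) * x ^ p) := by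
    rw [setLIntegral_congr_fun measurableSet_Ioi
      (g := fun t => ENNReal.ofReal (x ^ 2 * t ^ (p - 3)))
      (fun t ht => by simp only [scaleGauge_of_ge hx.le (hx.trans ht) (le_of_lt ht)]),
      ← ofReal_integral_eq_lintegral_ofReal hI2
        ((ae_restrict_iff' measurableSet_Ioi).2 (ae_of_all _ fun t ht => by
          have := hx.trans ht; simp only [Pi.zero_apply]; positivity)),
      integral_const_mul, integral_Ioi_rpow_of_lt (by linarith) hx]
    congr 1
    rw [show p - 3 + 1 = -(2 - p) by ring, neg_div_neg_eq]
    have : x ^ p = x ^ (-(2 - p)) * x ^ 2 := by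
      rw [← Real.rpow_natCast x 2, ← Real.rpow_add hx]
      congr 1
      push_cast
      ring
    rw [this]
    ring
  rw [← Set.Ioc_union_Ioi_eq_Ioi hx.le, lintegral_union measurableSet_Ioi
    (Set.Ioc_disjoint_Ioi le_rfl), e1, e2, ← ENNReal.ofReal_add, add_mul]
  · have : 0 < p - 1 := by linarith
    positivity
  · have : 0 < 2 - p := by linarith
    positivity

theorem min_self_sq_le {u v w : ℝ} (hu : 0 ≤ u) (hv : 0 ≤ v) (h : u ≤ v + w) :
    min u (u ^ 2) ≤ 2 * v + 4 * w ^ 2 := by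
  rcases le_total u (2 * v) with h' | h'
  · exact (min_le_left _ _).trans (by nlinarith [sq_nonneg w])
  · refine (min_le_right _ _).trans ?_
    nlinarith

/-- Real interpolation with a constant that does not depend on the exponent. The truncation of `a`
at height `t` splits `∑ a_i h_i` into an `L²` part and an `L¹` part, and averaging over `t` with
the gauge `min u u²` produces the same factor `1/(p-1) + 1/(2-p)` on both sides. -/
theorem lintegral_rpow_sum_le {ι Ω : Type*} [Fintype ι] [MeasurableSpace Ω] {ν : Measure Ω}
    [SFinite ν] {h : ι → Ω → ℂ} (hm : ∀ i, Measurable (h i)) {K : ℝ} (hK : 0 ≤ K)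
    (h1 : ∀ a : ι → ℂ, ∫⁻ x, ENNReal.ofReal ‖∑ i, a i * h i x‖ ∂ν ≤
      ENNReal.ofReal (K * ∑ i, ‖a i‖))
    (h2 : ∀ a : ι → ℂ, ∫⁻ x, ENNReal.ofReal (‖∑ i, a i * h i x‖ ^ 2) ∂ν ≤
      ENNReal.ofReal (K * ∑ i, ‖a i‖ ^ 2))
    {p : ℝ} (hp1 : 1 ≤ p) (hp2 : p ≤ 2) (a : ι → ℂ) :
    ∫⁻ x, ENNReal.ofReal (‖∑ i, a i * h i x‖ ^ p) ∂ν ≤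
      ENNReal.ofReal (4 * K * ∑ i, ‖a i‖ ^ p) := by
  rcases hp1.eq_or_lt with rfl | hp1
  · simp only [Real.rpow_one]
    refine (h1 a).trans (ENNReal.ofReal_le_ofReal ?_)
    have : 0 ≤ K * ∑ i, ‖a i‖ := by positivity
    linarith
  rcases hp2.eq_or_lt with rfl | hp2
  · simp only [Real.rpow_two]
    refine (h2 a).trans (ENNReal.ofReal_le_ofReal ?_)
    have : 0 ≤ K * ∑ i, ‖a i‖ ^ 2 := by positivity
    linarith
  set c : ℝ := 1 / (p - 1) + 1 / (2 - p) with hc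
  have hc0 : 0 < c := by
    have : 0 < p - 1 := by linarith
    have : 0 < 2 - p := by linarith
    positivity
  have hmF : ∀ b : ι → ℂ, Measurable fun x => ∑ i, b i * h i x := fun b =>
    Finset.measurable_sum _ fun i _ => (hm i).const_mul _
  have hscale : ∀ t ∈ Set.Ioi (0 : ℝ),
      ∫⁻ x, ENNReal.ofReal (scaleGauge p ‖∑ i, a i * h i x‖ t) ∂ν ≤
        ∑ i, ENNReal.ofReal (4 * K) * ENNReal.ofReal (scaleGauge p ‖a i‖ t) := by
    intro t ht
    have ht : 0 < t := ht
    set u : ι → ℂ := fun i => if t < ‖a i‖ then a i else 0 with hu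
    set v : ι → ℂ := fun i => if t < ‖a i‖ then 0 else a i with hv
    have huv : ∀ x, ∑ i, a i * h i x = ∑ i, u i * h i x + ∑ i, v i * h i x := fun x => by
      rw [← Finset.sum_add_distrib]
      refine Finset.sum_congr rfl fun i _ => ?_
      by_cases hi : t < ‖a i‖ <;> simp [hu, hv, hi]
    have hpt : ∀ x, ENNReal.ofReal (scaleGauge p ‖∑ i, a i * h i x‖ t) ≤
        ENNReal.ofReal (2 * t ^ (p - 2)) * ENNReal.ofReal ‖∑ i, u i * h i x‖ +
          ENNReal.ofReal (4 * t ^ (p - 3)) * ENNReal.ofReal (‖∑ i, v i * h i x‖ ^ 2) := fun x => by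
      rw [← ENNReal.ofReal_mul (by positivity), ← ENNReal.ofReal_mul (by positivity),
        ← ENNReal.ofReal_add (by positivity) (by positivity)]
      refine ENNReal.ofReal_le_ofReal ?_
      have hle := min_self_sq_le (u := ‖∑ i, a i * h i x‖ / t) (v := ‖∑ i, u i * h i x‖ / t)
        (w := ‖∑ i, v i * h i x‖ / t) (by positivity) (by positivity) (by
          rw [← add_div]
          exact div_le_div_of_nonneg_right (huv x ▸ norm_add_le _ _) ht.le)
      refine (mul_le_mul_of_nonneg_left hle (by positivity : 0 ≤ t ^ (p - 1))).trans_eq ?_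
      have e1 : t ^ (p - 2) = t ^ (p - 3) * t := by
        rw [← Real.rpow_add_one ht.ne']; ring_nf
      have e2 : t ^ (p - 1) = t ^ (p - 3) * t * t := by
        rw [← e1, ← Real.rpow_add_one ht.ne']; ring_nf
      rw [e2, e1]
      field_simp
    refine (lintegral_mono hpt).trans ?_
    rw [lintegral_add_left ((hmF u).norm.ennreal_ofReal.const_mul _),
      lintegral_const_mul _ (hmF u).norm.ennreal_ofReal,
      lintegral_const_mul _ ((hmF v).norm.pow_const 2).ennreal_ofReal]
    refine (add_le_add (mul_le_mul_right (h1 u) _) (mul_le_mul_right (h2 v) _)).trans ?_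
    simp only [← ENNReal.ofReal_mul (show 0 ≤ 4 * K by positivity)]
    rw [← ENNReal.ofReal_mul (by positivity), ← ENNReal.ofReal_mul (by positivity),
      ← ENNReal.ofReal_add (by positivity) (by positivity),
      ← ENNReal.ofReal_sum_of_nonneg fun i _ =>
        mul_nonneg (by positivity) (scaleGauge_nonneg (norm_nonneg _) ht)]
    refine ENNReal.ofReal_le_ofReal ?_
    simp only [Finset.mul_sum]
    rw [← Finset.sum_add_distrib]
    refine Finset.sum_le_sum fun i _ => ?_
    by_cases hi : t < ‖a i‖
    · have : 0 ≤ K * (‖a i‖ * t ^ (p - 2)) := by positivity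
      rw [scaleGauge_of_le ht hi.le]
      simp only [hu, hv, hi, if_true, norm_zero]
      linarith
    · rw [scaleGauge_of_ge (norm_nonneg _) ht (not_lt.1 hi)]
      simp only [hu, hv, hi, if_false, norm_zero]
      linarith
  have hmeas : Measurable fun q : Ω × ℝ =>
      ENNReal.ofReal (scaleGauge p ‖∑ i, a i * h i q.1‖ q.2) :=
    ((measurable_scaleGauge p).comp
      ((((hmF a).norm).comp measurable_fst).prodMk measurable_snd)).ennreal_ofReal
  have hmg : ∀ x : ℝ, Measurable fun t => ENNReal.ofReal (scaleGauge p x t) := fun x =>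
    ((measurable_scaleGauge p).comp (measurable_const.prodMk measurable_id)).ennreal_ofReal
  have key : ENNReal.ofReal c * ∫⁻ x, ENNReal.ofReal (‖∑ i, a i * h i x‖ ^ p) ∂ν ≤
      ENNReal.ofReal c * ENNReal.ofReal (4 * K * ∑ i, ‖a i‖ ^ p) := by
    calc ENNReal.ofReal c * ∫⁻ x, ENNReal.ofReal (‖∑ i, a i * h i x‖ ^ p) ∂ν
        = ∫⁻ x, (∫⁻ t in Set.Ioi (0 : ℝ),
            ENNReal.ofReal (scaleGauge p ‖∑ i, a i * h i x‖ t)) ∂ν := by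
          rw [← lintegral_const_mul _ ((hmF a).norm.pow_const p).ennreal_ofReal]
          refine lintegral_congr fun x => ?_
          rw [lintegral_scaleGauge hp1 hp2 (norm_nonneg _), ENNReal.ofReal_mul hc0.le]
      _ = ∫⁻ t in Set.Ioi (0 : ℝ), ∫⁻ x,
            ENNReal.ofReal (scaleGauge p ‖∑ i, a i * h i x‖ t) ∂ν :=
          lintegral_lintegral_swap hmeas.aemeasurable
      _ ≤ ∫⁻ t in Set.Ioi (0 : ℝ),
            ∑ i, ENNReal.ofReal (4 * K) * ENNReal.ofReal (scaleGauge p ‖a i‖ t) :=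
          setLIntegral_mono' measurableSet_Ioi hscale
      _ = ∑ i, ENNReal.ofReal (4 * K) * ENNReal.ofReal (c * ‖a i‖ ^ p) := by
          rw [lintegral_finsetSum _ fun i _ => (hmg _).const_mul _]
          refine Finset.sum_congr rfl fun i _ => ?_
          rw [lintegral_const_mul _ (hmg _), lintegral_scaleGauge hp1 hp2 (norm_nonneg _)]
      _ = _ := by
          simp only [← ENNReal.ofReal_mul (show 0 ≤ 4 * K by positivity)]
          rw [← ENNReal.ofReal_mul hc0.le,
            ← ENNReal.ofReal_sum_of_nonneg fun i _ => by positivity, Finset.mul_sum,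
            Finset.mul_sum]
          congr 1
          exact Finset.sum_congr rfl fun i _ => by ring
  exact (ENNReal.mul_le_mul_iff_right (by simpa using hc0) ENNReal.ofReal_ne_top).1 key

/-! ### Matrices close to the identity -/

/-- The Schur test on `ℓ^p`. -/
theorem schur_test {ι : Type*} [Fintype ι] {e : ι → ι → ℝ} (he : ∀ i j, 0 ≤ e i j) {B : ℝ}
    (hrow : ∀ i, ∑ j, e i j ≤ B) (hcol : ∀ j, ∑ i, e i j ≤ B) {p : ℝ} (hp : 1 ≤ p)
    {f : ι → ℝ} (hf : ∀ i, 0 ≤ f i) :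
    ∑ i, (∑ j, e i j * f j) ^ p ≤ B ^ p * ∑ j, f j ^ p := by
  rcases isEmpty_or_nonempty ι with _ | ⟨⟨i₀⟩⟩
  · simp
  have hp0 : 0 < p := by linarith
  have hB : 0 ≤ B := (Finset.sum_nonneg fun j _ => he i₀ j).trans (hrow i₀)
  have hi : ∀ i, (∑ j, e i j * f j) ^ p ≤ B ^ (p - 1) * ∑ j, e i j * f j ^ p := fun i => by
    have hs : 0 ≤ ∑ j, e i j := Finset.sum_nonneg fun j _ => he i j
    have hs' : 0 ≤ ∑ j, e i j * f j ^ p :=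
      Finset.sum_nonneg fun j _ => mul_nonneg (he i j) (Real.rpow_nonneg (hf j) _)
    have h := Real.inner_le_weight_mul_Lp_of_nonneg Finset.univ hp (e i) f (he i) hf
    have h' := Real.rpow_le_rpow
      (Finset.sum_nonneg fun j _ => mul_nonneg (he i j) (hf j)) h hp0.le
    rw [Real.mul_rpow (Real.rpow_nonneg hs _) (Real.rpow_nonneg hs' _), ← Real.rpow_mul hs,
      ← Real.rpow_mul hs', inv_mul_cancel₀ hp0.ne', Real.rpow_one, sub_mul,
      inv_mul_cancel₀ hp0.ne', one_mul] at h'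
    exact h'.trans (mul_le_mul_of_nonneg_right
      (Real.rpow_le_rpow hs (hrow i) (by linarith)) hs')
  calc ∑ i, (∑ j, e i j * f j) ^ p ≤ ∑ i, B ^ (p - 1) * ∑ j, e i j * f j ^ p :=
        Finset.sum_le_sum fun i _ => hi i
    _ = B ^ (p - 1) * ∑ j, (∑ i, e i j) * f j ^ p := by
        rw [← Finset.mul_sum, Finset.sum_comm]
        simp only [Finset.sum_mul]
    _ ≤ B ^ (p - 1) * ∑ j, B * f j ^ p := by
        refine mul_le_mul_of_nonneg_left (Finset.sum_le_sum fun j _ =>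
          mul_le_mul_of_nonneg_right (hcol j) (Real.rpow_nonneg (hf j) _)) (Real.rpow_nonneg hB _)
    _ = B ^ p * ∑ j, f j ^ p := by
        rw [← Finset.mul_sum, ← mul_assoc]
        congr 1
        rcases hB.eq_or_lt with rfl | hB
        · rw [mul_zero, Real.zero_rpow hp0.ne']
        · rw [← Real.rpow_add_one hB.ne', sub_add_cancel]

/-- An endomorphism at distance at most `1/2` from the identity has a right inverse of norm at
most `2`. -/
theorem exists_rightInverse_of_norm_sub_le {V : Type*} [NormedAddCommGroup V] [NormedSpace ℂ V]
    [FiniteDimensional ℂ V] (A : V →ₗ[ℂ] V) (hA : ∀ v, ‖A v - v‖ ≤ 1 / 2 * ‖v‖) :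
    ∃ B : V →ₗ[ℂ] V, (∀ v, A (B v) = v) ∧ ∀ v, ‖B v‖ ≤ 2 * ‖v‖ := by
  have hlow : ∀ v, ‖v‖ ≤ 2 * ‖A v‖ := fun v => by
    have h2 : ‖v‖ ≤ ‖A v‖ + ‖A v - v‖ := by
      simpa using norm_sub_le (A v) (A v - v)
    linarith [hA v]
  have hinj : Function.Injective A := by
    rw [← LinearMap.ker_eq_bot, LinearMap.ker_eq_bot']
    intro v hv
    simpa [hv] using hlow v
  refine ⟨(LinearEquiv.ofInjectiveEndo A hinj).symm, fun v => ?_, fun v => ?_⟩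
  · exact (LinearEquiv.ofInjectiveEndo A hinj).apply_symm_apply v
  · refine (hlow _).trans_eq ?_
    congr 2
    exact (LinearEquiv.ofInjectiveEndo A hinj).apply_symm_apply v

/-! ### The Gram matrix -/

/-- The reciprocal `(1 - |w¹|²)(1 - |w²|²)` of `‖S_w‖₂²`. -/
noncomputable def kernelScale (w : ℂ × ℂ) : ℝ := (1 - ‖w.1‖ ^ 2) * (1 - ‖w.2‖ ^ 2)

theorem kernelScale_pos {w : ℂ × ℂ} (hw : w ∈ bidisc) : 0 < kernelScale w := by
  have h1 := norm_fst_lt_one hw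
  have h2 := norm_snd_lt_one hw
  exact mul_pos (by nlinarith [norm_nonneg w.1]) (by nlinarith [norm_nonneg w.2])

theorem szego_apply (w : bidisc) {z : ℂ × ℂ} (hz : z ∈ bidisc) :
    szego w z = szegoKernel z w :=
  Set.indicator_of_mem hz fun z => szegoKernel z w

theorem szegoKernel_self (w : ℂ × ℂ) : szegoKernel w w = ((kernelScale w)⁻¹ : ℝ) := by
  simp only [szegoKernel, Complex.conj_mul', kernelScale]
  push_cast
  rw [one_div_mul_one_div, one_div]

theorem norm_szegoKernel_comm (v w : ℂ × ℂ) : ‖szegoKernel v w‖ = ‖szegoKernel w v‖ := by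
  have h : ∀ a b : ℂ, ‖1 - conj a * b‖ = ‖1 - conj b * a‖ := fun a b => by
    rw [← RCLike.norm_conj]
    simp [mul_comm]
  simp only [szegoKernel, norm_mul, norm_div, h v.1, h v.2]

theorem tendsto_szegoKernel_dilate (v w : bidisc) :
    Tendsto (fun r : ℝ => szegoKernel ((r : ℂ) ^ 2 * (w : ℂ × ℂ).1, (r : ℂ) ^ 2 * (w : ℂ × ℂ).2) v)
      (𝓝[<] 1) (𝓝 (szegoKernel w v)) := by
  have hne : ∀ {a b : ℂ}, ‖a‖ < 1 → ‖b‖ < 1 → 1 - conj a * b ≠ 0 := fun {a b} ha hb h => by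
    have := le_norm_one_sub (a := a) hb
    rw [h, norm_zero] at this
    linarith
  have h1 := hne (norm_fst_lt_one v.2) (norm_fst_lt_one w.2)
  have h2 := hne (norm_snd_lt_one v.2) (norm_snd_lt_one w.2)
  have hc : ContinuousAt (fun r : ℝ =>
      szegoKernel ((r : ℂ) ^ 2 * (w : ℂ × ℂ).1, (r : ℂ) ^ 2 * (w : ℂ × ℂ).2) v) 1 := by
    unfold szegoKernel
    refine ContinuousAt.mul (ContinuousAt.div (by fun_prop) (by fun_prop) (by simpa using h1))
      (ContinuousAt.div (by fun_prop) (by fun_prop) (by simpa using h2))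
  have := hc.tendsto
  simp only [Complex.ofReal_one, one_pow, one_mul] at this
  exact this.mono_left nhdsWithin_le_nhds

theorem Ioo_mem_nhdsLT_one : Set.Ioo (0 : ℝ) 1 ∈ 𝓝[<] (1 : ℝ) :=
  Ioo_mem_nhdsLT one_pos

theorem integral_norm_sq_szegoKernel {r : ℝ} (hr : r ∈ Set.Ioo (0 : ℝ) 1) (w : bidisc) :
    ((∫ θ : Torus, ‖szegoKernel (torusPoint r θ) w‖ ^ 2 : ℝ) : ℂ) =
      szegoKernel ((r : ℂ) ^ 2 * (w : ℂ × ℂ).1, (r : ℂ) ^ 2 * (w : ℂ × ℂ).2) w := by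
  rw [← integral_szegoKernel_mul_conj hr w.2 w.2, ← integral_complex_ofReal]
  refine integral_congr_ae (ae_of_all _ fun θ => ?_)
  simp only [Complex.mul_conj']
  push_cast
  rfl

theorem continuous_szegoKernel_torusPoint {r : ℝ} (hr : r ∈ Set.Ioo (0 : ℝ) 1) (w : bidisc) :
    Continuous fun θ : Torus => szegoKernel (torusPoint r θ) w :=
  (continuous_comp_torusPoint (szego w).differentiableOn hr).congr fun θ =>
    szego_apply w (torusPoint_mem hr θ)

theorem integrable_of_continuous_torus {f : Torus → ℝ} (hf : Continuous f) :
    Integrable f volume :=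
  hf.integrable_of_hasCompactSupport (HasCompactSupport.of_compactSpace f)

theorem eLpNorm_szego_sq {r : ℝ} (hr : r ∈ Set.Ioo (0 : ℝ) 1) (w : bidisc) :
    eLpNorm (fun θ : Torus => szego w (torusPoint r θ)) 2 volume ^ 2 =
      ENNReal.ofReal (∫ θ : Torus, ‖szegoKernel (torusPoint r θ) w‖ ^ 2) := by
  have h := eLpNorm_nnreal_pow_eq_lintegral (f := fun θ : Torus => szego w (torusPoint r θ))
    (μ := volume) (p := 2) two_ne_zero
  simp only [NNReal.coe_ofNat, ENNReal.coe_ofNat, ENNReal.rpow_ofNat] at h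
  rw [h, ofReal_integral_eq_lintegral_ofReal
    (integrable_of_continuous_torus (f := fun θ => ‖szegoKernel (torusPoint r θ) w‖ ^ 2)
      ((continuous_szegoKernel_torusPoint hr w).norm.pow 2))
    (ae_of_all _ fun θ => by positivity)]
  refine lintegral_congr fun θ => ?_
  rw [szego_apply w (torusPoint_mem hr θ), ENNReal.ofReal_pow (norm_nonneg _), ofReal_norm]

theorem integral_norm_sq_szegoKernel_le {r : ℝ} (hr : r ∈ Set.Ioo (0 : ℝ) 1) (w : bidisc) :
    ∫ θ : Torus, ‖szegoKernel (torusPoint r θ) w‖ ^ 2 ≤ (kernelScale w)⁻¹ := by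
  have h := integral_normSq_sum_szegoKernel_pow_le (ι := Unit) 0 hr (fun _ => w) fun _ => 1
  simpa [szegoKernel_self, abs_of_pos (kernelScale_pos w.2)] using h

theorem norm_szego_sq (w : bidisc) : ‖szego w‖ ^ 2 = (kernelScale w)⁻¹ := by
  have hq := kernelScale_pos w.2
  have key : hardyENorm 2 (szego w) ^ 2 = ENNReal.ofReal (kernelScale w)⁻¹ := by
    rw [hardyENorm]
    apply le_antisymm
    · have : Nonempty (Set.Ioo (0 : ℝ) 1) := ⟨1 / 2, by norm_num, by norm_num⟩
      rw [ENNReal.iSup_pow]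
      refine iSup_le fun r => ?_
      rw [eLpNorm_szego_sq r.2]
      exact ENNReal.ofReal_le_ofReal (integral_norm_sq_szegoKernel_le r.2 w)
    · have ht := (Complex.continuous_re.tendsto _).comp (tendsto_szegoKernel_dilate w w)
      rw [szegoKernel_self, Complex.ofReal_re] at ht
      refine le_of_tendsto (ENNReal.tendsto_ofReal ht) ?_
      filter_upwards [Ioo_mem_nhdsLT_one] with r hr
      rw [Function.comp_apply, ← integral_norm_sq_szegoKernel hr, Complex.ofReal_re,
        ← eLpNorm_szego_sq hr]
      exact pow_le_pow_left₀ zero_le (le_iSup (fun r : Set.Ioo (0 : ℝ) 1 =>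
        eLpNorm (fun θ : Torus => szego w (torusPoint r θ)) 2 volume) ⟨r, hr⟩) 2
  rw [HardySpace.norm_def, ← ENNReal.toReal_pow, key, ENNReal.toReal_ofReal (by positivity)]

theorem hardyInner_normalizedSzego (v w : bidisc) :
    hardyInner (normalizedSzego v) (normalizedSzego w) =
      (‖szego v‖ : ℂ)⁻¹ * (‖szego w‖ : ℂ)⁻¹ * szegoKernel w v := by
  refine Tendsto.limUnder_eq
    (((tendsto_szegoKernel_dilate v w).const_mul _).congr' ?_)
  filter_upwards [Ioo_mem_nhdsLT_one] with r hr
  rw [← integral_szegoKernel_mul_conj hr v.2 w.2, ← integral_const_mul]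
  refine integral_congr_ae (ae_of_all _ fun θ => ?_)
  simp only [normalizedSzego, HardySpace.coe_smul, Pi.smul_apply, smul_eq_mul, map_mul, map_inv₀,
    Complex.conj_ofReal, szego_apply _ (torusPoint_mem hr θ)]
  ring

theorem norm_gramMatrix {ι : Type*} {l : ι → bidisc} {q : ℝ} (hq : ∀ i, kernelScale (l i) = q)
    (n m : ι) : ‖gramMatrix l n m‖ = q * ‖szegoKernel (l m) (l n)‖ := by
  have hq0 : 0 < q := hq n ▸ kernelScale_pos (l n).2
  have hN : ∀ i, ‖szego (l i)‖ = √q⁻¹ := fun i => by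
    rw [← hq i, ← norm_szego_sq, Real.sqrt_sq (norm_nonneg _)]
  rw [gramMatrix, hardyInner_normalizedSzego, norm_mul, norm_mul, norm_inv, norm_inv,
    Complex.norm_real, Complex.norm_real, norm_norm, norm_norm, hN, hN, ← mul_inv,
    Real.mul_self_sqrt (by positivity), inv_inv]

theorem sq_le_of_weakSepConst {ι : Type*} [Finite ι] {l : ι → bidisc} {γ : ℝ} (hγ : 0 < γ)
    (h : γ ≤ weakSepConst l) {i j : ι} (hij : i ≠ j) : ‖gramMatrix l i j‖ ^ 2 ≤ 1 - γ ^ 2 := by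
  have h1 := (Real.le_sqrt' hγ).1 h
  have h2 : ‖gramMatrix l i j‖ ≤ ⨆ q : {q : ι × ι // q.1 ≠ q.2}, ‖gramMatrix l q.1.1 q.1.2‖ :=
    le_ciSup (f := fun q : {q : ι × ι // q.1 ≠ q.2} => ‖gramMatrix l q.1.1 q.1.2‖)
      (Set.finite_range _).bddAbove ⟨(i, j), hij⟩
  have := pow_le_pow_left₀ (norm_nonneg _) h2 2
  linarith

theorem sum_sq_le_of_columnConst {ι : Type*} [Fintype ι] [DecidableEq ι] {l : ι → bidisc} {Δ : ℝ}
    (hΔ : 0 ≤ Δ) (h : columnConst l ≤ ENNReal.ofReal Δ) (j : ι) :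
    ∑ i, (if i = j then 0 else ‖gramMatrix l i j‖ ^ 2) ≤ Δ := by
  have h1 := (le_iSup (fun m : ι => ∑' n : {n : ι // n ≠ m}, ‖gramMatrix l n m‖ₑ ^ 2) j).trans h
  rw [tsum_fintype, ← Finset.sum_subtype (Finset.univ.filter (· ≠ j)) (by simp)
    (fun i => ‖gramMatrix l i j‖ₑ ^ 2)] at h1
  simp only [← ofReal_norm, ← ENNReal.ofReal_pow (norm_nonneg _)] at h1
  rw [← ENNReal.ofReal_sum_of_nonneg fun i _ => by positivity,
    ENNReal.ofReal_le_ofReal_iff hΔ, Finset.sum_filter] at h1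
  refine le_of_eq_of_le (Finset.sum_congr rfl fun i _ => ?_) h1
  by_cases hij : i = j <;> simp [hij]

/-! ### Synthesis with powers of the kernel -/

section Synthesis

variable {ι : Type*} [Fintype ι] {l : ι → bidisc} {q : ℝ}

theorem integral_norm_szegoKernel_pow_le {r : ℝ} (hr : r ∈ Set.Ioo (0 : ℝ) 1) (s : ℕ)
    (w : bidisc) : ∫ θ : Torus, ‖(kernelScale w * szegoKernel (torusPoint r θ) w) ^ (2 * s + 2)‖ ≤
      kernelScale w * ((2 * s).choose s : ℝ) ^ 2 := by
  have hq := kernelScale_pos w.2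
  have h := integral_normSq_sum_szegoKernel_pow_le (ι := Unit) s hr (fun _ => w)
    fun _ => ((kernelScale w : ℂ)) ^ (s + 1)
  simp only [Finset.univ_unique, Finset.sum_singleton, szegoKernel_self, Complex.norm_real,
    norm_inv, norm_pow, Real.norm_eq_abs, abs_of_pos hq] at h
  calc _ = ∫ θ : Torus,
        ‖(kernelScale w : ℂ) ^ (s + 1) * szegoKernel (torusPoint r θ) w ^ (s + 1)‖ ^ 2 := by
        refine integral_congr_ae (ae_of_all _ fun θ => ?_)
        simp only [norm_mul, norm_pow]
        ring
    _ ≤ _ := h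
    _ = _ := by
        rw [inv_pow, show 2 * s + 1 = s + 1 + s by ring, pow_add _ (s + 1) s]
        field_simp
        ring

/-- The `ℓ² → L²` bound. The squared coefficients of `S^{m+1}` are dominated by those of `S^{2m+1}`,
so the relevant Gram matrix is controlled entrywise by `|⟨g_i, g_j⟩|²`. -/
theorem integral_sq_synthesis_le [DecidableEq ι] (hq0 : 0 < q) (hq : ∀ i, kernelScale (l i) = q)
    {Δ : ℝ} (hle : ∀ i j, q * ‖szegoKernel (l j) (l i)‖ ≤ 1)
    (hcol : ∀ j, ∑ i, (if i = j then 0 else (q * ‖szegoKernel (l j) (l i)‖) ^ 2) ≤ Δ)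
    {m : ℕ} (hm : 1 ≤ m) {r : ℝ} (hr : r ∈ Set.Ioo (0 : ℝ) 1) (a : ι → ℂ) :
    ∫ θ : Torus, ‖∑ i, a i * (q * szegoKernel (torusPoint r θ) (l i)) ^ (m + 1)‖ ^ 2 ≤
      q * (((2 * m).choose m : ℝ) ^ 2 * (1 + Δ)) * ∑ i, ‖a i‖ ^ 2 := by
  set g : ι → ι → ℝ := fun i j => q * ‖szegoKernel (l j) (l i)‖ with hg
  have hg0 : ∀ i j, 0 ≤ g i j := fun i j => by positivity
  have hsymm : ∀ i j, g i j = g j i := fun i j => by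
    simp only [hg, norm_szegoKernel_comm (l j)]
  have hdiag : ∀ i, g i i = 1 := fun i => by
    simp only [hg, szegoKernel_self, Complex.norm_real, norm_inv, hq, Real.norm_eq_abs,
      abs_of_pos hq0]
    exact mul_inv_cancel₀ hq0.ne'
  have hcol' : ∀ j, ∑ i, g i j ^ 2 ≤ 1 + Δ := fun j => by
    have : ∑ i, g i j ^ 2 =
        ∑ i, ((if i = j then 1 else 0) + (if i = j then 0 else g i j ^ 2)) :=
      Finset.sum_congr rfl fun i _ => by
        by_cases hij : i = j
        · simp [hij, hdiag]
        · simp [hij]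
    rw [this, Finset.sum_add_distrib]
    simpa using hcol j
  have h := integral_normSq_sum_szegoKernel_pow_le m hr l fun i => a i * (q : ℂ) ^ (m + 1)
  have hF : ∀ θ : Torus, ∑ i, a i * (q * szegoKernel (torusPoint r θ) (l i)) ^ (m + 1) =
      ∑ i, a i * (q : ℂ) ^ (m + 1) * szegoKernel (torusPoint r θ) (l i) ^ (m + 1) := fun θ =>
    Finset.sum_congr rfl fun i _ => by ring
  simp only [hF]
  refine h.trans ?_
  have hpow : ∀ i j, g i j ^ (2 * m + 1) ≤ g i j ^ 2 := fun i j =>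
    pow_le_pow_of_le_one (hg0 i j) (hle i j) (by omega)
  have hterm : ∀ i j, ‖a i * (q : ℂ) ^ (m + 1)‖ * ‖a j * (q : ℂ) ^ (m + 1)‖ *
      ‖szegoKernel (l j) (l i)‖ ^ (2 * m + 1) ≤
        q * (1 / 2 * (g i j ^ 2 * ‖a i‖ ^ 2 + g i j ^ 2 * ‖a j‖ ^ 2)) := fun i j => by
    have e : ‖a i * (q : ℂ) ^ (m + 1)‖ * ‖a j * (q : ℂ) ^ (m + 1)‖ *
        ‖szegoKernel (l j) (l i)‖ ^ (2 * m + 1) = q * (g i j ^ (2 * m + 1) * (‖a i‖ * ‖a j‖)) := by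
      simp only [hg, norm_mul, norm_pow, Complex.norm_real, Real.norm_eq_abs, abs_of_pos hq0]
      ring
    rw [e]
    refine mul_le_mul_of_nonneg_left ?_ hq0.le
    calc g i j ^ (2 * m + 1) * (‖a i‖ * ‖a j‖) ≤ g i j ^ 2 * (‖a i‖ * ‖a j‖) :=
          mul_le_mul_of_nonneg_right (hpow i j) (by positivity)
      _ ≤ g i j ^ 2 * ((‖a i‖ ^ 2 + ‖a j‖ ^ 2) / 2) :=
          mul_le_mul_of_nonneg_left (by nlinarith [sq_nonneg (‖a i‖ - ‖a j‖)]) (by positivity)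
      _ = _ := by ring
  have hs1 : ∑ i, ∑ j, g i j ^ 2 * ‖a i‖ ^ 2 ≤ (1 + Δ) * ∑ i, ‖a i‖ ^ 2 := by
    rw [Finset.mul_sum]
    refine Finset.sum_le_sum fun i _ => ?_
    rw [← Finset.sum_mul]
    refine mul_le_mul_of_nonneg_right ?_ (by positivity)
    simpa only [hsymm i] using hcol' i
  have hs2 : ∑ i, ∑ j, g i j ^ 2 * ‖a j‖ ^ 2 ≤ (1 + Δ) * ∑ i, ‖a i‖ ^ 2 := by
    rw [Finset.sum_comm]
    simpa only [hsymm] using hs1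
  calc _ ≤ ((2 * m).choose m : ℝ) ^ 2 * ∑ i, ∑ j,
        q * (1 / 2 * (g i j ^ 2 * ‖a i‖ ^ 2 + g i j ^ 2 * ‖a j‖ ^ 2)) :=
        mul_le_mul_of_nonneg_left
          (Finset.sum_le_sum fun i _ => Finset.sum_le_sum fun j _ => hterm i j) (by positivity)
    _ = ((2 * m).choose m : ℝ) ^ 2 * (q * (1 / 2 *
        (∑ i, ∑ j, g i j ^ 2 * ‖a i‖ ^ 2 + ∑ i, ∑ j, g i j ^ 2 * ‖a j‖ ^ 2))) := by
        simp only [← Finset.mul_sum, ← Finset.sum_add_distrib]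
    _ ≤ ((2 * m).choose m : ℝ) ^ 2 * (q * (1 / 2 *
        ((1 + Δ) * ∑ i, ‖a i‖ ^ 2 + (1 + Δ) * ∑ i, ‖a i‖ ^ 2))) := by gcongr
    _ = _ := by ring

/-- The norm bound `synthesisConst s Δ` for the synthesis with the powers `S^{2s+2}`. -/
noncomputable def synthesisConst (s : ℕ) (Δ : ℝ) : ℝ :=
  ((2 * (2 * s + 1)).choose (2 * s + 1) : ℝ) ^ 2 * (1 + Δ) + ((2 * s).choose s : ℝ) ^ 2

theorem synthesisConst_nonneg (s : ℕ) {Δ : ℝ} (hΔ : 0 ≤ Δ) : 0 ≤ synthesisConst s Δ := by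
  unfold synthesisConst
  positivity

/-- The `ℓ^p → L^p` bound, where `ℓ^p` carries the weight `q`; the operator does not depend
on `p`. -/
theorem lintegral_synthesis_le [DecidableEq ι] (hq0 : 0 < q) (hq : ∀ i, kernelScale (l i) = q)
    {Δ : ℝ} (hΔ : 0 ≤ Δ) (hle : ∀ i j, q * ‖szegoKernel (l j) (l i)‖ ≤ 1)
    (hcol : ∀ j, ∑ i, (if i = j then 0 else (q * ‖szegoKernel (l j) (l i)‖) ^ 2) ≤ Δ)
    (s : ℕ) {r : ℝ} (hr : r ∈ Set.Ioo (0 : ℝ) 1) {p : ℝ} (hp1 : 1 ≤ p) (hp2 : p ≤ 2) (a : ι → ℂ) :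
    ∫⁻ θ : Torus, ENNReal.ofReal
      (‖∑ i, a i * (q * szegoKernel (torusPoint r θ) (l i)) ^ (2 * s + 2)‖ ^ p) ≤
      ENNReal.ofReal (4 * (q * synthesisConst s Δ) * ∑ i, ‖a i‖ ^ p) := by
  have hcont : ∀ i, Continuous fun θ : Torus =>
      (q * szegoKernel (torusPoint r θ) (l i)) ^ (2 * s + 2) := fun i =>
    (continuous_const.mul (continuous_szegoKernel_torusPoint hr (l i))).pow _
  have hcontF : ∀ a : ι → ℂ, Continuous fun θ : Torus =>
      ‖∑ i, a i * (q * szegoKernel (torusPoint r θ) (l i)) ^ (2 * s + 2)‖ := fun a =>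
    (continuous_finsetSum _ fun i _ => continuous_const.mul (hcont i)).norm
  refine lintegral_rpow_sum_le (h := fun i θ =>
    (q * szegoKernel (torusPoint r θ) (l i)) ^ (2 * s + 2)) (fun i => (hcont i).measurable)
    (mul_nonneg hq0.le (synthesisConst_nonneg s hΔ)) (fun a => ?_) (fun a => ?_) hp1 hp2 a
  · rw [← ofReal_integral_eq_lintegral_ofReal (integrable_of_continuous_torus (hcontF a))
      (ae_of_all _ fun θ => norm_nonneg _)]
    refine ENNReal.ofReal_le_ofReal ?_
    calc ∫ θ : Torus, ‖∑ i, a i * (q * szegoKernel (torusPoint r θ) (l i)) ^ (2 * s + 2)‖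
        ≤ ∫ θ : Torus,
            ∑ i, ‖a i‖ * ‖(q * szegoKernel (torusPoint r θ) (l i)) ^ (2 * s + 2)‖ := by
          refine integral_mono (integrable_of_continuous_torus (hcontF a))
            (integrable_of_continuous_torus
              (continuous_finsetSum _ fun i _ => continuous_const.mul (hcont i).norm)) fun θ => ?_
          exact (norm_sum_le _ _).trans_eq (Finset.sum_congr rfl fun i _ => norm_mul _ _)
      _ = ∑ i, ‖a i‖ * ∫ θ : Torus,
            ‖(q * szegoKernel (torusPoint r θ) (l i)) ^ (2 * s + 2)‖ := by
          rw [integral_finsetSum _ fun i _ =>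
            (integrable_of_continuous_torus (hcont i).norm).const_mul _]
          exact Finset.sum_congr rfl fun i _ => integral_const_mul _ _
      _ ≤ ∑ i, ‖a i‖ * (q * ((2 * s).choose s : ℝ) ^ 2) := by
          refine Finset.sum_le_sum fun i _ => mul_le_mul_of_nonneg_left ?_ (norm_nonneg _)
          simpa only [hq] using integral_norm_szegoKernel_pow_le hr s (l i)
      _ = q * ((2 * s).choose s : ℝ) ^ 2 * ∑ i, ‖a i‖ := by
          rw [← Finset.sum_mul, mul_comm]
      _ ≤ _ := by
          refine mul_le_mul_of_nonneg_right (mul_le_mul_of_nonneg_left ?_ hq0.le) (by positivity)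
          exact le_add_of_nonneg_left (by positivity)
  · rw [← ofReal_integral_eq_lintegral_ofReal
      (integrable_of_continuous_torus (f := fun θ =>
        ‖∑ i, a i * (q * szegoKernel (torusPoint r θ) (l i)) ^ (2 * s + 2)‖ ^ 2)
        ((hcontF a).pow 2)) (ae_of_all _ fun θ => by positivity)]
    refine ENNReal.ofReal_le_ofReal
      ((integral_sq_synthesis_le hq0 hq hle hcol (m := 2 * s + 1) (by omega) hr a).trans ?_)
    refine mul_le_mul_of_nonneg_right (mul_le_mul_of_nonneg_left ?_ hq0.le) (by positivity)
    exact le_add_of_nonneg_right (by positivity)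

/-- The function `∑ a_i q^{-1/p} (q S_{l_i})^{2s+2}`. The terms vanish off the bidisc together with
the extension by zero of `S_{l_i}`. -/
noncomputable def synthesisFun (s : ℕ) (p q : ℝ) (l : ι → bidisc) (a : ι → ℂ) (z : ℂ × ℂ) : ℂ :=
  ∑ i, a i * ((q ^ (-(1 / p)) : ℝ) * (q * szego (l i) z) ^ (2 * s + 2))

theorem differentiableOn_synthesisFun (s : ℕ) (p : ℝ) (a : ι → ℂ) :
    DifferentiableOn ℂ (synthesisFun s p q l a) bidisc := by
  unfold synthesisFun
  exact DifferentiableOn.fun_sum fun i _ =>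
    ((((szego (l i)).differentiableOn.const_mul _).pow _).const_mul _).const_mul _

theorem hardyENorm_synthesisFun_le [DecidableEq ι] (hq0 : 0 < q)
    (hq : ∀ i, kernelScale (l i) = q)
    {Δ : ℝ} (hΔ : 0 ≤ Δ) (hle : ∀ i j, q * ‖szegoKernel (l j) (l i)‖ ≤ 1)
    (hcol : ∀ j, ∑ i, (if i = j then 0 else (q * ‖szegoKernel (l j) (l i)‖) ^ 2) ≤ Δ)
    (s : ℕ) {p : ℝ≥0∞} (hp1 : 1 ≤ p) (hp2 : p ≤ 2) (a : ι → ℂ) :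
    hardyENorm p (synthesisFun s p.toReal q l a) ≤
      ENNReal.ofReal ((4 * synthesisConst s Δ + 1) *
        (∑ i, ‖a i‖ ^ p.toReal) ^ (1 / p.toReal)) := by
  have hptop : p ≠ ∞ := (hp2.trans_lt (by simp)).ne
  have ht1 : 1 ≤ p.toReal := by simpa using ENNReal.toReal_mono hptop hp1
  have ht2 : p.toReal ≤ 2 := by simpa using ENNReal.toReal_mono (by simp) hp2
  have ht0 : 0 < p.toReal := by linarith
  have hK := synthesisConst_nonneg s hΔ
  set S : ℝ := ∑ i, ‖a i‖ ^ p.toReal with hS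
  have hS0 : 0 ≤ S := by positivity
  refine iSup_le fun r => ?_
  rw [eLpNorm_eq_lintegral_rpow_enorm_toReal (zero_lt_one.trans_le hp1).ne' hptop]
  have hF : ∀ θ : Torus, ‖synthesisFun s p.toReal q l a (torusPoint r θ)‖ₑ ^ p.toReal =
      ENNReal.ofReal (‖∑ i, (a i * (q ^ (-(1 / p.toReal)) : ℝ)) *
        (q * szegoKernel (torusPoint r θ) (l i)) ^ (2 * s + 2)‖ ^ p.toReal) := fun θ => by
    rw [← ENNReal.ofReal_rpow_of_nonneg (norm_nonneg _) ht0.le, ofReal_norm, synthesisFun]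
    congr 2
    exact Finset.sum_congr rfl fun i _ => by
      rw [szego_apply _ (torusPoint_mem r.2 θ), mul_assoc]
  simp only [hF]
  have hsum : ∑ i, ‖a i * ((q ^ (-(1 / p.toReal)) : ℝ) : ℂ)‖ ^ p.toReal = q⁻¹ * S := by
    rw [hS, Finset.mul_sum]
    refine Finset.sum_congr rfl fun i _ => ?_
    have hqp := Real.rpow_nonneg hq0.le (-(1 / p.toReal))
    rw [norm_mul, Complex.norm_real, Real.norm_of_nonneg hqp, Real.mul_rpow (norm_nonneg _) hqp,
      ← Real.rpow_mul hq0.le, neg_mul, one_div, inv_mul_cancel₀ ht0.ne', Real.rpow_neg_one,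
      mul_comm]
  have h := lintegral_synthesis_le hq0 hq hΔ hle hcol s r.2 ht1 ht2
    fun i => a i * ((q ^ (-(1 / p.toReal)) : ℝ) : ℂ)
  rw [hsum, show 4 * (q * synthesisConst s Δ) * (q⁻¹ * S) = 4 * synthesisConst s Δ * S by
    field_simp] at h
  refine (ENNReal.rpow_le_rpow h (by positivity)).trans ?_
  rw [ENNReal.ofReal_rpow_of_nonneg (by positivity) (by positivity)]
  refine ENNReal.ofReal_le_ofReal ?_
  rw [Real.mul_rpow (by positivity) hS0]
  refine mul_le_mul_of_nonneg_right ?_ (by positivity)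
  calc (4 * synthesisConst s Δ) ^ (1 / p.toReal)
      ≤ (4 * synthesisConst s Δ + 1) ^ (1 / p.toReal) :=
        Real.rpow_le_rpow (by positivity) (by linarith) (by positivity)
    _ ≤ (4 * synthesisConst s Δ + 1) ^ (1 : ℝ) :=
        Real.rpow_le_rpow_of_exponent_le (by linarith) ((div_le_one ht0).2 ht1)
    _ = _ := Real.rpow_one _

end Synthesis

/-! ### The right inverse of the restriction operator -/

/-- The synthesis operator `a ↦ ∑ a_i q^{-1/p} (q S_{l_i})^{2s+2}` into `H^p(𝔻²)`, given that its
values have finite norm. -/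
noncomputable def synthesisOp {ι : Type*} [Fintype ι] (s : ℕ) (p : ℝ≥0∞) [Fact (1 ≤ p)] (q : ℝ)
    (l : ι → bidisc) (h : ∀ a : ι → ℂ, hardyENorm p (synthesisFun s p.toReal q l a) < ∞) :
    PiLp p (fun _ : ι => ℂ) →ₗ[ℂ] HardySpace p where
  toFun a := ⟨synthesisFun s p.toReal q l a, differentiableOn_synthesisFun s p.toReal a,
    fun z hz => by simp [synthesisFun, HardySpace.eq_zero_of_notMem _ hz], h a⟩
  map_add' a b := by
    refine HardySpace.ext fun z _ => ?_
    change synthesisFun s p.toReal q l _ z =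
      synthesisFun s p.toReal q l _ z + synthesisFun s p.toReal q l _ z
    simp [synthesisFun, add_mul, Finset.sum_add_distrib]
  map_smul' c a := by
    refine HardySpace.ext fun z _ => ?_
    change synthesisFun s p.toReal q l _ z = c * synthesisFun s p.toReal q l _ z
    simp [synthesisFun, Finset.mul_sum, mul_assoc]

theorem synthesisOp_apply {ι : Type*} [Fintype ι] (s : ℕ) (p : ℝ≥0∞) [Fact (1 ≤ p)] (q : ℝ)
    (l : ι → bidisc) (h : ∀ a : ι → ℂ, hardyENorm p (synthesisFun s p.toReal q l a) < ∞)
    (a : PiLp p (fun _ : ι => ℂ)) :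
    (synthesisOp s p q l h a : ℂ × ℂ → ℂ) = synthesisFun s p.toReal q l a := rfl

theorem restrictionOp_synthesisOp {Λ : Finset bidisc} (s : ℕ) (p : ℝ≥0∞) [Fact (1 ≤ p)] {q : ℝ}
    (hq0 : 0 < q) (hq : ∀ w : Λ, kernelScale (w : bidisc) = q)
    (h : ∀ a : Λ → ℂ, hardyENorm p (synthesisFun s p.toReal q (fun w : Λ => (w : bidisc)) a) < ∞)
    (a : PiLp p (fun _ : Λ => ℂ)) (w : Λ) :
    restrictionOp p Λ (synthesisOp s p q (fun w : Λ => (w : bidisc)) h a) w =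
      ∑ v, a v * (q * szegoKernel (w : bidisc) (v : bidisc)) ^ (2 * s + 2) := by
  change synthesisFun s p.toReal q _ a _ * _ = _
  have h1 : 0 ≤ 1 - ‖((w : bidisc) : ℂ × ℂ).1‖ ^ 2 := by
    nlinarith [norm_nonneg ((w : bidisc) : ℂ × ℂ).1, norm_fst_lt_one (w : bidisc).2]
  have h2 : 0 ≤ 1 - ‖((w : bidisc) : ℂ × ℂ).2‖ ^ 2 := by
    nlinarith [norm_nonneg ((w : bidisc) : ℂ × ℂ).2, norm_snd_lt_one (w : bidisc).2]
  have hw : (1 - ‖((w : bidisc) : ℂ × ℂ).1‖ ^ 2) * (1 - ‖((w : bidisc) : ℂ × ℂ).2‖ ^ 2) = q := hq w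
  have hqq : (((q ^ (-(1 / p.toReal)) : ℝ) : ℂ)) * ((q ^ (1 / p.toReal) : ℝ) : ℂ) = 1 := by
    rw [← Complex.ofReal_mul, ← Real.rpow_add hq0, neg_add_cancel, Real.rpow_zero,
      Complex.ofReal_one]
  rw [← Real.mul_rpow h1 h2, hw, synthesisFun, Finset.sum_mul]
  refine Finset.sum_congr rfl fun v _ => ?_
  rw [szego_apply _ (w : bidisc).2]
  linear_combination (a v * (q * szegoKernel (w : bidisc) (v : bidisc)) ^ (2 * s + 2)) * hqq

/-- A matrix with unit diagonal whose off-diagonal rows and columns have sum at most `1/2` moves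
vectors of `ℓ^p` by at most half of their norm. -/
theorem norm_sub_le_of_offDiag_le {ι : Type*} [Fintype ι] [DecidableEq ι] {p : ℝ≥0∞}
    [Fact (1 ≤ p)] (hp : p ≠ ∞) {M : ι → ι → ℂ} (hdiag : ∀ i, M i i = 1)
    (hrow : ∀ i, ∑ j, (if j = i then 0 else ‖M i j‖) ≤ 1 / 2)
    (hcol : ∀ j, ∑ i, (if j = i then 0 else ‖M i j‖) ≤ 1 / 2)
    {a b : PiLp p (fun _ : ι => ℂ)} (hb : ∀ i, b i = ∑ j, a j * M i j) :
    ‖b - a‖ ≤ 1 / 2 * ‖a‖ := by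
  have hp1 : 1 ≤ p.toReal := by simpa using ENNReal.toReal_mono hp (Fact.out : 1 ≤ p)
  have hp0 : 0 < p.toReal := by linarith
  have hpt : ∀ i, ‖(b - a) i‖ ≤ ∑ j, (if j = i then 0 else ‖M i j‖) * ‖a j‖ := fun i => by
    have e : (b - a) i = ∑ j, if j = i then 0 else a j * M i j := by
      rw [PiLp.sub_apply, hb, ← Finset.add_sum_erase _ _ (Finset.mem_univ i), hdiag, mul_one,
        add_sub_cancel_left, ← Finset.add_sum_erase _ (fun j => if j = i then 0 else a j * M i j)
          (Finset.mem_univ i)]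
      simp only [if_true, zero_add]
      exact Finset.sum_congr rfl fun j hj => by rw [if_neg (Finset.ne_of_mem_erase hj)]
    rw [e]
    refine (norm_sum_le _ _).trans_eq (Finset.sum_congr rfl fun j _ => ?_)
    by_cases hj : j = i <;> simp [hj, mul_comm]
  have h := schur_test (e := fun i j => if j = i then 0 else ‖M i j‖) (B := 1 / 2)
    (fun i j => by positivity) hrow hcol hp1 (f := fun j => ‖a j‖) fun j => norm_nonneg _
  rw [PiLp.norm_eq_sum hp0, PiLp.norm_eq_sum hp0]
  calc (∑ i, ‖(b - a) i‖ ^ p.toReal) ^ (1 / p.toReal)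
      ≤ ((1 / 2 : ℝ) ^ p.toReal * ∑ j, ‖a j‖ ^ p.toReal) ^ (1 / p.toReal) := by
        refine Real.rpow_le_rpow (by positivity) (le_trans ?_ h) (by positivity)
        exact Finset.sum_le_sum fun i _ => Real.rpow_le_rpow (norm_nonneg _) (hpt i) hp0.le
    _ = _ := by
        rw [Real.mul_rpow (by positivity) (by positivity), ← Real.rpow_mul (by norm_num),
          mul_one_div_cancel hp0.ne', Real.rpow_one]

/-- The quantitative form: if `s` is so large that `ρ^s Δ ≤ 1/2`, where `ρ` bounds the squares of
the off-diagonal Gram entries, then the synthesis with exponent `2s+2` is an approximate right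
inverse. -/
theorem exists_rightInverse_restrictionOp {p : ℝ≥0∞} [Fact (1 ≤ p)] (hp2 : p ≤ 2)
    {Λ : Finset bidisc} {q : ℝ} (hq0 : 0 < q) (hq : ∀ w : Λ, kernelScale (w : bidisc) = q)
    {ρ Δ : ℝ} (hΔ : 0 ≤ Δ) (hρ0 : 0 ≤ ρ) (hρ1 : ρ ≤ 1)
    (hsep : ∀ v w : Λ, v ≠ w → (q * ‖szegoKernel (w : bidisc) (v : bidisc)‖) ^ 2 ≤ ρ)
    (hcol : ∀ w : Λ, ∑ v : Λ,
      (if v = w then 0 else (q * ‖szegoKernel (w : bidisc) (v : bidisc)‖) ^ 2) ≤ Δ)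
    {s : ℕ} (hs : ρ ^ s * Δ ≤ 1 / 2) :
    ∃ R : PiLp p (fun _ : Λ => ℂ) →L[ℂ] HardySpace p,
      (∀ a : PiLp p (fun _ : Λ => ℂ), restrictionOp p Λ (R a) = a) ∧
        ‖R‖ ≤ (4 * synthesisConst s Δ + 1) * 2 := by
  classical
  have hptop : p ≠ ∞ := (hp2.trans_lt (by simp)).ne
  have hp1 : 1 ≤ p.toReal := by simpa using ENNReal.toReal_mono hptop (Fact.out : 1 ≤ p)
  have hp0 : 0 < p.toReal := by linarith
  have hK := synthesisConst_nonneg s hΔ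
  have hdiag : ∀ w : Λ, (q : ℂ) * szegoKernel (w : bidisc) (w : bidisc) = 1 := fun w => by
    rw [szegoKernel_self, hq, ← Complex.ofReal_mul, mul_inv_cancel₀ hq0.ne', Complex.ofReal_one]
  have hle : ∀ v w : Λ, q * ‖szegoKernel (w : bidisc) (v : bidisc)‖ ≤ 1 := fun v w => by
    by_cases hvw : v = w
    · have := congrArg norm (hdiag w)
      rw [norm_mul, Complex.norm_real, Real.norm_of_nonneg hq0.le, norm_one] at this
      rw [hvw, this]
    · exact (sq_le_one_iff₀ (by positivity)).1 ((hsep v w hvw).trans hρ1)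
  have hbound := fun a : Λ → ℂ => hardyENorm_synthesisFun_le (l := fun w : Λ => (w : bidisc))
    hq0 hq hΔ hle hcol s (Fact.out : 1 ≤ p) hp2 a
  set T := synthesisOp s p q (fun w : Λ => (w : bidisc))
    fun a => (hbound a).trans_lt ENNReal.ofReal_lt_top with hT
  have hTnorm : ∀ a, ‖T a‖ ≤ (4 * synthesisConst s Δ + 1) * ‖a‖ := fun a => by
    rw [HardySpace.norm_def, hT, synthesisOp_apply, PiLp.norm_eq_sum hp0]
    exact ENNReal.toReal_le_of_le_ofReal (by positivity) (hbound a)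
  have hcol' : ∀ w : Λ, ∑ v : Λ, (if v = w then 0 else
      ‖(q * szegoKernel (w : bidisc) (v : bidisc)) ^ (2 * s + 2)‖) ≤ 1 / 2 := fun w => by
    refine le_trans ?_ ((mul_le_mul_of_nonneg_left (hcol w) (pow_nonneg hρ0 s)).trans hs)
    rw [Finset.mul_sum]
    refine Finset.sum_le_sum fun v _ => ?_
    by_cases hvw : v = w
    · simp [hvw]
    · rw [if_neg hvw, if_neg hvw, norm_pow, norm_mul, Complex.norm_real,
        Real.norm_of_nonneg hq0.le, pow_add, pow_mul]
      exact mul_le_mul_of_nonneg_right (pow_le_pow_left₀ (by positivity) (hsep v w hvw) s)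
        (by positivity)
  obtain ⟨B, hB, hBnorm⟩ := exists_rightInverse_of_norm_sub_le (restrictionOp p Λ ∘ₗ T) fun a =>
    norm_sub_le_of_offDiag_le hptop
      (M := fun w v : Λ => (q * szegoKernel (w : bidisc) (v : bidisc)) ^ (2 * s + 2))
      (fun w => by rw [hdiag, one_pow]) hcol'
      (fun v => by
        refine le_of_eq_of_le (Finset.sum_congr rfl fun w _ => ?_) (hcol' v)
        simp only [norm_pow, norm_mul, norm_szegoKernel_comm (w : bidisc), eq_comm (a := v)])
      (a := a) fun w => restrictionOp_synthesisOp s p hq0 hq _ a w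
  refine ⟨LinearMap.mkContinuous (T ∘ₗ B) ((4 * synthesisConst s Δ + 1) * 2) fun a => ?_,
    hB, LinearMap.mkContinuous_norm_le _ (by positivity) _⟩
  refine (hTnorm _).trans ?_
  rw [mul_assoc]
  exact mul_le_mul_of_nonneg_left (hBnorm a) (by positivity)

theorem proposition4p2 (γ Δ : ℝ) (hγ : 0 < γ) (hΔ : 0 < Δ) :
    ∃ C : ℝ, 0 < C ∧
      ∀ (p : ℝ≥0∞) [Fact (1 ≤ p)], p ≤ 2 →
        ∀ Λ : Finset bidisc,
          IsWeaklySeparatedWith γ Λ →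
          IsColumnBoundedWith Δ Λ →
          (∀ v ∈ Λ, ∀ w ∈ Λ, ‖szego v‖ = ‖szego w‖) →
          ∃ R : PiLp p (fun _ : Λ => ℂ) →L[ℂ] HardySpace p,
            (∀ a : PiLp p (fun _ : Λ => ℂ), restrictionOp p Λ (R a) = a) ∧ ‖R‖ ≤ C := by
  classical
  -- The maximum only matters for `γ > 1`, where no set is `γ` weakly separated.
  set ρ : ℝ := max 0 (1 - γ ^ 2) with hρ
  have hρ1 : ρ < 1 := max_lt one_pos (by nlinarith)
  obtain ⟨s, hs⟩ := exists_pow_lt_of_lt_one (show 0 < 1 / (2 * Δ) by positivity) hρ1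
  have hs' : ρ ^ s * Δ ≤ 1 / 2 := by
    refine (mul_le_mul_of_nonneg_right hs.le hΔ.le).trans_eq ?_
    field_simp
  have hK := synthesisConst_nonneg s hΔ.le
  refine ⟨(4 * synthesisConst s Δ + 1) * 2, by positivity, fun p _ hp2 Λ hsep hcol hnorm => ?_⟩
  obtain ⟨q, hq0, hq⟩ : ∃ q : ℝ, 0 < q ∧ ∀ w : Λ, kernelScale (w : bidisc) = q := by
    rcases Λ.eq_empty_or_nonempty with rfl | ⟨v, hv⟩
    · exact ⟨1, one_pos, fun w => absurd w.2 (Finset.notMem_empty _)⟩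
    · refine ⟨kernelScale v, kernelScale_pos v.2, fun w => ?_⟩
      rw [← inv_inj, ← norm_szego_sq, ← norm_szego_sq, hnorm w w.2 v hv]
  have hG : ∀ v w : Λ, ‖gramMatrix (fun w : Λ => (w : bidisc)) v w‖ =
      q * ‖szegoKernel (w : bidisc) (v : bidisc)‖ := norm_gramMatrix hq
  refine exists_rightInverse_restrictionOp hp2 hq0 hq hΔ.le (le_max_left _ _) hρ1.le
    (fun v w hvw => ?_) (fun w => ?_) hs'
  · rw [← hG]
    exact (sq_le_of_weakSepConst hγ hsep hvw).trans (le_max_right _ _)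
  · simpa only [hG] using sum_sq_le_of_columnConst hΔ.le hcol w
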